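/- Let $(\Omega,\mathcal F,\mathbb P)$ be a probability space, let $L^\infty$ be the space of essentially bounded real random variables modulo $\mathbb P$-a.s. equality, and let $\mathcal M_1$ be the set of probability measures on $(\Omega,\mathcal F)$ that are absolutely continuous with respect to $\mathbb P$; for $\mu\in\mathcal M_1$ write $\mathbb E^\mu[X]=\mathbb E[\tfrac{d\mu}{d\mathbb P}X]$. For a sub-$\sigma$-algebra $\mathcal G\subseteq\mathcal F$, let $L^\infty(\mathcal G)$ be the set of $\mathcal G$-measurable elements of $L^\infty$, and let $\mathcal M(\mathcal G)$ be the space of finite signed measures on $(\Omega,\mathcal G)$ that are absolutely continuous with respect to $\mathbb P|_{\mathcal G}$, with the weak topology $w(\mathcal M(\mathcal G),L^\infty(\mathcal G))$ induced by the pairing $(\mu,X)\mapsto\mathbb E[\tfrac{d\mu}{d\mathbb P|_{\mathcal G}}X]$. For $\mathcal S\subseteq\mathcal M_1$ put $\mathcal S^{\mathcal G}=\{\mu|_{\mathcal G}:\mu\in\mathcal S\}$. A set $\mathcal R\subseteq\mathcal M(\mathcal G)$ is called almost $\mathcal G$-law invariant if the set $\{\tfrac{d\mu}{d\mathbb P|_{\mathcal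 G}}:\mu\in\overline{\mathcal R}\}$, where $\overline{\mathcal R}$ is the $w(\mathcal M(\mathcal G),L^\infty(\mathcal G))$-closure of $\mathcal R$, contains with each $X$ every $\mathcal G$-measurable real random variable having the same distribution as $X$ under $\mathbb P$ (random variables are identified if they agree $\mathbb P$-a.s.). The $\sigma$-algebra $\mathcal G$ is atomless if $\{\mathbb P(A):A\subseteq B,\ A\in\mathcal G\}=[0,\mathbb P(B)]$ for all $B\in\mathcal G$. A map $\rho:L^\infty\to\mathbb R$ is a coherent risk measure if, for all $X,Y\in L^\infty$: $\rho(X+c)=\rho(X)+c$ for $c\in\mathbb R$; $\rho(X)\le\rho(Y)$ if $X\le Y$ a.s.; $\rho(\lambda X+(1-\lambda)Y)\le\lambda\rho(X)+(1-\lambda)\rho(Y)$ for $\lambda\in[0,1]$; and $\rho(\lambda X)=\lambda\rho(X)$ for $\lambda\ge0$. It is Fatou if $\rho(X)\le\liminf_{n}\rho(X_n)$ for every uniformly bounded sequence $(X_n)$ in $L^\infty$ converging $\mathbb P$-a.s. to $X\in L^\infty$. It is $\mathcal G$-law invariant if $\rho(X)=\rho(Y)$ for all $X,Y\in L^\infty(\mathcal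 G)$ with the same distribution under $\mathbb P$. Theorem. Let $\mathfrak G$ be any set of atomless sub-$\sigma$-algebras of $\mathcal F$. A map $\rho:L^\infty\to\mathbb R$ is a Fatou coherent risk measure that is $\mathcal G$-law invariant for every $\mathcal G\in\mathfrak G$ if and only if there is a convex set $\mathcal S\subseteq\mathcal M_1$ such that $\mathcal S^{\mathcal G}$ is almost $\mathcal G$-law invariant for each $\mathcal G\in\mathfrak G$ and $$\rho(X)=\sup_{\mu\in\mathcal S}\mathbb E^\mu[X]\qquad\text{for all }X\in L^\infty .$$ -/

import Mathlib

open MeasureTheory ProbabilityTheory Filter Topology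
open scoped ENNReal

noncomputable section

namespace PartialLaw

section Space

/- A generic probability space `(Ω, m, Q)`. It is used both for the reference space
`(Ω, ℱ, ℙ)` and for `(Ω, 𝒢, ℙ|𝒢)`, where `ℙ|𝒢 = ℙ.trim h𝒢`. -/
variable {Ω : Type*} {m : MeasurableSpace Ω} (Q : Measure Ω)

/-- `L^∞(Ω, m, Q)`: essentially bounded random variables modulo a.s. equality. -/
abbrev LInf : Type _ := Lp ℝ ∞ Q

/-- `(Ω, m, Q)` is atomless: `{Q(A) : A ⊆ B, A ∈ m} = [0, Q(B)]` for all `B ∈ m`. -/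
def Atomless : Prop :=
  ∀ B : Set Ω, MeasurableSet B →
    {t : ℝ≥0∞ | ∃ A : Set Ω, A ⊆ B ∧ MeasurableSet A ∧ Q A = t} = Set.Icc 0 (Q B)

/-- `ℳ`: the vector space of finite signed measures on `(Ω, m)` that are absolutely continuous
with respect to `Q`. -/
def ACSigned : Submodule ℝ (SignedMeasure Ω) where
  carrier := {μ | μ ≪ᵥ Q.toENNRealVectorMeasure}
  add_mem' := fun h₁ h₂ => h₁.add h₂
  zero_mem' := VectorMeasure.AbsolutelyContinuous.zero _
  smul_mem' := fun c _ h s hs => by simp [h hs]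

/-- `ℳ₁`: the probability measures in `ℳ`. -/
def ACProb : Set (ACSigned Q) :=
  {μ | 0 ≤ (μ : SignedMeasure Ω) ∧ (μ : SignedMeasure Ω) Set.univ = 1}

variable {Q}

/-- The Radon–Nikodym derivative `D_μ = dμ/dQ`, as an element of `L⁰`. -/
def density (μ : ACSigned Q) : Ω →ₘ[Q] ℝ :=
  AEEqFun.mk ((μ : SignedMeasure Ω).rnDeriv Q)
    (SignedMeasure.measurable_rnDeriv _ Q).aestronglyMeasurable

/-- `E^μ[X] = E[D_μ X]`, the dual pairing of `ℳ` and `L^∞`. -/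
def expect (μ : ACSigned Q) (X : LInf Q) : ℝ :=
  ∫ ω, density μ ω * X ω ∂Q

variable (Q) in
/-- The weak topology `w(ℳ, L^∞)`: the coarsest topology on `ℳ` for which every
`μ ↦ E^μ[X]`, `X ∈ L^∞`, is continuous. -/
@[reducible] def weakTopology : TopologicalSpace (ACSigned Q) :=
  TopologicalSpace.induced (fun μ (X : LInf Q) => expect μ X) inferInstance

/-- A set `A ⊆ L⁰(Ω, m, Q)` is law invariant: `X ∈ A` and `Y ∈ L⁰(Ω, m, Q)` with the same
distribution as `X` under `Q` imply `Y ∈ A`. -/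
def LawInvariantSet (A : Set (Ω →ₘ[Q] ℝ)) : Prop :=
  ∀ X ∈ A, ∀ Y : Ω →ₘ[Q] ℝ, IdentDistrib X Y Q Q → Y ∈ A

/-- A set `S ⊆ ℳ` is almost law invariant: the set of the densities of the members of the
`w(ℳ, L^∞)`-closure of `S` is law invariant. -/
def AlmostLawInvariant (S : Set (ACSigned Q)) : Prop :=
  LawInvariantSet (density '' (closure[weakTopology Q] S))

end Space

section SubSigmaAlgebra

variable {Ω : Type*} {mΩ : MeasurableSpace Ω} {P : Measure Ω}

variable (P) in
/-- `Σ(ℱ)`: the atomless sub-σ-algebras of `ℱ`. -/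
def AtomlessSub : Set (MeasurableSpace Ω) :=
  {𝒢 | ∃ h𝒢 : 𝒢 ≤ mΩ, Atomless (P.trim h𝒢)}

theorem trim_absolutelyContinuous {𝒢 mΩ : MeasurableSpace Ω} {P : Measure[mΩ] Ω} (h𝒢 : 𝒢 ≤ mΩ)
    {μ : @SignedMeasure Ω mΩ} (hμ : μ ≪ᵥ P.toENNRealVectorMeasure) :
    μ.trim h𝒢 ≪ᵥ (P.trim h𝒢).toENNRealVectorMeasure := by
  refine VectorMeasure.AbsolutelyContinuous.mk (m := 𝒢) fun s hs h0 => ?_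
  rw [VectorMeasure.trim_measurableSet_eq h𝒢 hs]
  refine hμ ?_
  rw [@Measure.toENNRealVectorMeasure_apply_measurable Ω 𝒢 _ s hs,
    trim_measurableSet_eq h𝒢 hs] at h0
  rw [Measure.toENNRealVectorMeasure_apply_measurable (h𝒢 s hs), h0]

/-- The restriction `μ|𝒢` of `μ ∈ ℳ` to a sub-σ-algebra `𝒢`, an element of `ℳ(𝒢)`. -/
def restrictSub {𝒢 : MeasurableSpace Ω} (h𝒢 : 𝒢 ≤ mΩ) (μ : ACSigned P) :
    ACSigned (P.trim h𝒢) :=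
  ⟨μ.1.trim h𝒢, trim_absolutelyContinuous h𝒢 μ.2⟩

/-- `ρ : L^∞ → ℝ` is `𝒢`-law invariant: `ρ(X) = ρ(Y)` for all `𝒢`-measurable `X, Y ∈ L^∞` with the
same distribution under `P`. -/
def LawInvariant {Ω : Type*} (𝒢 : MeasurableSpace Ω) {mΩ : MeasurableSpace Ω}
    {P : Measure[mΩ] Ω} (ρ : LInf P → ℝ) : Prop :=
  ∀ X Y : LInf P, AEStronglyMeasurable[𝒢] X P → AEStronglyMeasurable[𝒢] Y P →
    IdentDistrib X Y P P → ρ X = ρ Y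

/-- Coherent risk measures on `L^∞`. -/
structure Coherent [IsProbabilityMeasure P] (ρ : LInf P → ℝ) : Prop where
  cash_invariance : ∀ (X : LInf P) (c : ℝ), ρ (X + Lp.const ∞ P c) = ρ X + c
  monotonicity : ∀ X Y : LInf P, X ≤ Y → ρ X ≤ ρ Y
  convexity : ∀ (X Y : LInf P) (l : ℝ), 0 ≤ l → l ≤ 1 →
    ρ (l • X + (1 - l) • Y) ≤ l * ρ X + (1 - l) * ρ Y
  positive_homogeneity : ∀ (X : LInf P) (l : ℝ), 0 ≤ l → ρ (l • X) = l * ρ X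

/-- Fatou continuity: `ρ(X) ≤ liminf ρ(Xₙ)` for every uniformly bounded sequence `(Xₙ)` in `L^∞`
converging a.s. to `X ∈ L^∞`. The limes inferior is taken in `[-∞, ∞]`. -/
def Fatou (ρ : LInf P → ℝ) : Prop :=
  ∀ (Xs : ℕ → LInf P) (X : LInf P), (∃ C : ℝ, ∀ n, ‖Xs n‖ ≤ C) →
    (∀ᵐ ω ∂P, Tendsto (fun n => Xs n ω) atTop (𝓝 (X ω))) →
    (ρ X : EReal) ≤ liminf (fun n => (ρ (Xs n) : EReal)) atTop

end SubSigmaAlgebra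

end PartialLaw

end

/-! The representing formula says that `ρ` is the support function of `S`, and every property of `ρ`
is read off from `S` through the pairing `expect`. Three facts carry the proof.

Duality (`Coherent.exists_lt_expect`). If `t < ρ X₀`, the convex set of `Z` with `ρ (X₀ - Z) ≤ t`
misses `0`, and the Fatou property makes its bounded parts closed in `L²`. A Krein–Šmulian argument
in the Hilbert space `L²` separates it from `0` by a functional that is `L²`-continuous on bounded
sets. Such a functional is countably additive on indicators, and after normalisation it is a
probability measure dominated by `ρ`. So `ρ` is the supremum over the convex set `dualSet ρ`.

Restriction (`expect_restrictSub`). For `𝒢`-measurable `X`, the expectation depends only on the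
restriction of `μ` to `𝒢`. Hence `ρ` on the `𝒢`-measurable variables is the support function of the
restricted set, and each `𝒢` can be treated separately on its own atomless space.

Rearrangement (`Halving.exists_identDistrib_integral_mul`). On an atomless space, replacing one
factor of `∫ f w` by a variable of the same law can be compensated, up to `ε`, by replacing the
other factor likewise. Moving a law change from the density to `X`, together with the bipolar
theorem, shows that a law invariant support function comes from an almost law invariant convex set.
Moving it from `X` to the density gives the converse. -/

noncomputable section

namespace PartialLaw

/-! ### Uniform variables and couplings on atomless spaces -/

section Coupling

variable {Ω : Type*} {m : MeasurableSpace Ω}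

/-- Every measurable set can be split into two measurable halves of equal mass. -/
def Halving (μ : Measure Ω) : Prop :=
  ∀ B : Set Ω, MeasurableSet B → ∃ A ⊆ B, MeasurableSet A ∧ μ A = μ B / 2

theorem Atomless.halving {Q : Measure Ω} (h : Atomless Q) : Halving Q := by
  intro B hB
  have : Q B / 2 ∈ Set.Icc 0 (Q B) := ⟨zero_le, ENNReal.half_le_self⟩
  rw [← h B hB] at this
  obtain ⟨A, h1, h2, h3⟩ := this
  exact ⟨A, h1, h2, h3⟩

theorem Halving.restrict {μ : Measure Ω} (h : Halving μ) {S : Set Ω} (hS : MeasurableSet S) :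
    Halving (μ.restrict S) := by
  intro B hB
  obtain ⟨A, h1, h2, h3⟩ := h (B ∩ S) (hB.inter hS)
  refine ⟨A, h1.trans Set.inter_subset_left, h2, ?_⟩
  rw [Measure.restrict_apply h2, Measure.restrict_apply hB, ← h3,
    Set.inter_eq_left.2 (h1.trans Set.inter_subset_right)]

/-- Halving all level sets of `T` at once appends one binary digit to `T`. -/
theorem Halving.exists_refinement {μ : Measure Ω} [IsFiniteMeasure μ] (h : Halving μ) (T : Ω → ℕ)
    (hT : Measurable T) :
    ∃ T' : Ω → ℕ, Measurable T' ∧ (∀ ω, T' ω = 2 * T ω ∨ T' ω = 2 * T ω + 1) ∧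
      ∀ k, μ (T' ⁻¹' {k}) = μ (T ⁻¹' {k / 2}) / 2 := by
  classical
  choose A hAs hAm hAμ using fun k : ℕ => h (T ⁻¹' {k}) (hT (measurableSet_singleton k))
  have hTA : ∀ {ω k}, ω ∈ A k → T ω = k := fun {ω k} hω => hAs k hω
  have hA : ∀ ω k, T ω = k → (ω ∈ ⋃ k, A k ↔ ω ∈ A k) := by
    intro ω k hk
    rw [Set.mem_iUnion]
    refine ⟨fun ⟨j, hj⟩ => ?_, fun hj => ⟨k, hj⟩⟩
    have := hTA hj
    rwa [← hk, this]
  have hHm : MeasurableSet (⋃ k, A k) := MeasurableSet.iUnion hAm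
  refine ⟨fun ω => 2 * T ω + if ω ∈ ⋃ k, A k then 1 else 0, ?_, ?_, ?_⟩
  · exact (hT.const_mul 2).add (Measurable.ite hHm measurable_const measurable_const)
  · intro ω
    by_cases hω : ω ∈ ⋃ k, A k
    · right; simp only [hω, if_true]
    · left; simp only [hω, if_false, add_zero]
  · intro k
    rcases Nat.even_or_odd' k with ⟨j, rfl | rfl⟩
    · have : (fun ω => 2 * T ω + if ω ∈ ⋃ k, A k then 1 else 0) ⁻¹' {2 * j}
          = T ⁻¹' {j} \ A j := by
        ext ω
        simp only [Set.mem_preimage, Set.mem_singleton_iff, Set.mem_sdiff]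
        constructor
        · intro hh
          split_ifs at hh with h1
          · omega
          · have : T ω = j := by omega
            exact ⟨this, fun h2 => h1 ((hA ω j this).2 h2)⟩
        · rintro ⟨h1, h2⟩
          rw [if_neg (fun h3 => h2 ((hA ω j h1).1 h3)), h1, add_zero]
      rw [this, measure_sdiff (hAs j) (hAm j).nullMeasurableSet (measure_ne_top _ _), hAμ,
        show 2 * j / 2 = j by omega, ENNReal.sub_half (measure_ne_top _ _)]
    · have : (fun ω => 2 * T ω + if ω ∈ ⋃ k, A k then 1 else 0) ⁻¹' {2 * j + 1} = A j := by
        ext ω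
        simp only [Set.mem_preimage, Set.mem_singleton_iff]
        constructor
        · intro hh
          split_ifs at hh with h1
          · exact (hA ω j (by omega)).1 h1
          · omega
        · intro h1
          rw [if_pos ((hA ω j (hTA h1)).2 h1), hTA h1]
      rw [this, hAμ, show (2 * j + 1) / 2 = j by omega]

/-- Iterated refinement: `T n` is the integer formed by the first `n` binary digits of the uniform
variable to be built. -/
theorem Halving.exists_dyadic {μ : Measure Ω} [IsFiniteMeasure μ] (h : Halving μ) :
    ∃ T : ℕ → Ω → ℕ, (∀ n, Measurable (T n)) ∧
      (∀ n ω, T (n + 1) ω = 2 * T n ω ∨ T (n + 1) ω = 2 * T n ω + 1) ∧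
      (∀ n ω, T n ω < 2 ^ n) ∧
      ∀ n, ∀ j ≤ 2 ^ n, μ {ω | T n ω < j} = j * (μ Set.univ / 2 ^ n) := by
  choose! F hFm hF hFμ using fun (T : Ω → ℕ) (hT : Measurable T) => h.exists_refinement T hT
  let T : ℕ → Ω → ℕ := fun n => Nat.rec (fun _ => 0) (fun _ t => F t) n
  have hTm : ∀ n, Measurable (T n) := by
    intro n
    induction n with
    | zero => exact measurable_const
    | succ n ih => exact hFm _ ih
  have hT1 : ∀ n ω, T (n + 1) ω = 2 * T n ω ∨ T (n + 1) ω = 2 * T n ω + 1 :=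
    fun n ω => hF _ (hTm n) ω
  have hTk : ∀ n, ∀ k < 2 ^ n, μ (T n ⁻¹' {k}) = μ Set.univ / 2 ^ n := by
    intro n
    induction n with
    | zero =>
      intro k hk
      have : k = 0 := by simpa using hk
      subst this
      have : T 0 ⁻¹' {0} = Set.univ := by ext; simp [T]
      rw [this]; simp
    | succ n ih =>
      intro k hk
      change μ (F (T n) ⁻¹' {k}) = _
      rw [hFμ _ (hTm n), ih _ (by rw [pow_succ] at hk; omega), pow_succ, div_eq_mul_inv,
        div_eq_mul_inv, div_eq_mul_inv, ENNReal.mul_inv (by simp) (by simp), mul_assoc]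
  refine ⟨T, hTm, hT1, ?_, ?_⟩
  · intro n ω
    induction n with
    | zero => simp [T]
    | succ n ih => rcases hT1 n ω with h | h <;> rw [h, pow_succ] <;> omega
  · intro n j
    induction j with
    | zero => intro _; simp
    | succ j ih =>
      intro hj
      have : {ω | T n ω < j + 1} = {ω | T n ω < j} ∪ T n ⁻¹' {j} := by
        ext ω; simp [le_iff_lt_or_eq]
      rw [this, measure_union _ (hTm n (measurableSet_singleton j)), ih (by omega),
        hTk n j (by omega)]
      · push_cast; ring
      · rw [Set.disjoint_left]
        intro ω h1 h2
        simp only [Set.mem_ofPred_eq, Set.mem_preimage, Set.mem_singleton_iff] at h1 h2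
        omega

/-- The dyadic intervals `[T n / 2 ^ n, (T n + 1) / 2 ^ n]` are nested, and their common point is
uniformly distributed. -/
theorem Halving.exists_uniform {μ : Measure Ω} [IsFiniteMeasure μ] (h : Halving μ) :
    ∃ U : Ω → unitInterval, Measurable U ∧ μ.map U = μ Set.univ • volume := by
  obtain ⟨T, hTm, hT1, hT2, hTμ⟩ := h.exists_dyadic
  have hmono : ∀ ω, Monotone fun n => (T n ω : ℝ) / 2 ^ n := by
    intro ω
    refine monotone_nat_of_le_succ fun n => ?_
    rw [div_le_div_iff₀ (by positivity) (by positivity), pow_succ]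
    have : (2 * T n ω : ℝ) ≤ T (n + 1) ω := by
      rcases hT1 n ω with h | h <;> rw [h] <;> push_cast <;> linarith
    nlinarith [pow_pos (two_pos (α := ℝ)) n]
  have hanti : ∀ ω, Antitone fun n => ((T n ω : ℝ) + 1) / 2 ^ n := by
    intro ω
    refine antitone_nat_of_succ_le fun n => ?_
    rw [div_le_div_iff₀ (by positivity) (by positivity), pow_succ]
    have : (T (n + 1) ω : ℝ) ≤ 2 * T n ω + 1 := by
      rcases hT1 n ω with h | h <;> rw [h] <;> push_cast <;> linarith
    nlinarith [pow_pos (two_pos (α := ℝ)) n]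
  have hle : ∀ ω n k, (T n ω : ℝ) / 2 ^ n ≤ ((T k ω : ℝ) + 1) / 2 ^ k := by
    intro ω n k
    calc (T n ω : ℝ) / 2 ^ n ≤ (T (max n k) ω : ℝ) / 2 ^ (max n k) := hmono ω (le_max_left _ _)
      _ ≤ ((T (max n k) ω : ℝ) + 1) / 2 ^ (max n k) := by gcongr; linarith
      _ ≤ _ := hanti ω (le_max_right _ _)
  have hbdd : ∀ ω, BddAbove (Set.range fun n => (T n ω : ℝ) / 2 ^ n) :=
    fun ω => ⟨_, Set.forall_mem_range.2 fun n => hle ω n 0⟩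
  let u : Ω → ℝ := fun ω => ⨆ n, (T n ω : ℝ) / 2 ^ n
  have hu1 : ∀ ω n, (T n ω : ℝ) / 2 ^ n ≤ u ω := fun ω n => le_ciSup (hbdd ω) n
  have hu2 : ∀ ω n, u ω ≤ ((T n ω : ℝ) + 1) / 2 ^ n := fun ω n => ciSup_le fun k => hle ω k n
  have hum : Measurable u := by
    refine measurable_of_tendsto_metrizable (f := fun n ω => (T n ω : ℝ) / 2 ^ n) ?_ ?_
    · intro n
      exact (measurable_from_top.comp (hTm n)).div_const _
    · exact tendsto_pi_nhds.2 fun ω => tendsto_atTop_ciSup (hmono ω) (hbdd ω)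
  have huI : ∀ ω, u ω ∈ unitInterval := by
    intro ω
    refine ⟨le_trans (by positivity) (hu1 ω 0), (hu2 ω 0).trans ?_⟩
    have := hT2 0 ω
    have h0 : T 0 ω = 0 := by simpa using this
    simp [h0]
  refine ⟨fun ω => ⟨u ω, huI ω⟩, hum.subtype_mk, ?_⟩
  have hUm : Measurable fun ω => (⟨u ω, huI ω⟩ : unitInterval) := hum.subtype_mk
  have hfin : IsFiniteMeasure (μ Set.univ • (volume : Measure unitInterval)) :=
    ⟨by simp [measure_lt_top]⟩
  refine Measure.ext_of_Iic _ _ fun x => ?_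
  rw [Measure.map_apply hUm measurableSet_Iic, Measure.smul_apply, unitInterval.volume_Iic]
  have hpre : (fun ω => (⟨u ω, huI ω⟩ : unitInterval)) ⁻¹' Set.Iic x = {ω | u ω ≤ x} := by
    ext ω; simp [← Subtype.coe_le_coe]
  rw [hpre, smul_eq_mul, ← ENNReal.ofReal_toReal (measure_ne_top μ Set.univ),
    ← ENNReal.ofReal_mul ENNReal.toReal_nonneg,
    ← ENNReal.ofReal_toReal (measure_ne_top μ {ω | u ω ≤ x})]
  congr 1
  set c := (μ Set.univ).toReal with hc
  have hreal : ∀ n, ∀ j ≤ 2 ^ n, (μ {ω | T n ω < j}).toReal = c * (j / 2 ^ n) := by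
    intro n j hj
    rw [hTμ n j hj]
    simp [ENNReal.toReal_mul, ENNReal.toReal_div, hc]
    ring
  have hxle : (x : ℝ) ≤ 1 := x.2.2
  have hx0 : (0 : ℝ) ≤ x := x.2.1
  have hc0 : 0 ≤ c := ENNReal.toReal_nonneg
  have hj : ∀ n : ℕ, ⌊(x : ℝ) * 2 ^ n⌋₊ ≤ 2 ^ n := by
    intro n
    rw [← Nat.floor_natCast (R := ℝ) (2 ^ n)]
    refine Nat.floor_le_floor ?_
    push_cast
    nlinarith [pow_pos (two_pos (α := ℝ)) n]
  -- With `j = ⌊x * 2 ^ n⌋₊`, the event `u ≤ x` lies between `T n < j` and `T n < j + 1`, whose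
  -- masses are known.
  have key : ∀ n : ℕ, |(μ {ω | u ω ≤ x}).toReal - c * x| ≤ c * (1 / 2 ^ n) := by
    intro n
    set j := ⌊(x : ℝ) * 2 ^ n⌋₊ with hjdef
    have hp : (0 : ℝ) < 2 ^ n := by positivity
    have hj1 : (j : ℝ) ≤ x * 2 ^ n := Nat.floor_le (by positivity)
    have hj2 : (x : ℝ) * 2 ^ n < j + 1 := Nat.lt_floor_add_one _
    have lo : c * (j / 2 ^ n) ≤ (μ {ω | u ω ≤ x}).toReal := by
      rw [← hreal n j (hj n)]
      refine ENNReal.toReal_mono (measure_ne_top _ _) (measure_mono fun ω hω => ?_)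
      refine (hu2 ω n).trans ?_
      rw [div_le_iff₀ hp]
      have : (T n ω : ℝ) + 1 ≤ j := by exact_mod_cast hω
      linarith
    have hi : (μ {ω | u ω ≤ x}).toReal ≤ c * ((j + 1) / 2 ^ n) := by
      -- The inequality fails only for `x = 1`, where the total mass is a sufficient bound.
      by_cases hlt : j + 1 ≤ 2 ^ n
      · have := hreal n (j + 1) hlt
        push_cast at this
        rw [← this]
        refine ENNReal.toReal_mono (measure_ne_top _ _) (measure_mono fun ω hω => ?_)
        have h1 := (hu1 ω n).trans hω
        rw [div_le_iff₀ hp] at h1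
        have h2 := h1.trans_lt hj2
        exact_mod_cast h2
      · have h1 : (1 : ℝ) ≤ (j + 1) / 2 ^ n := by
          rw [le_div_iff₀ hp]
          have : 2 ^ n ≤ j + 1 := by omega
          have : (2 : ℝ) ^ n ≤ j + 1 := by exact_mod_cast this
          linarith
        calc (μ {ω | u ω ≤ x}).toReal ≤ c :=
              ENNReal.toReal_mono (measure_ne_top _ _) (measure_mono (Set.subset_univ _))
          _ ≤ _ := le_mul_of_one_le_right hc0 h1
    have e1 : (x : ℝ) ≤ (j + 1) / 2 ^ n := by rw [le_div_iff₀ hp]; linarith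
    have e2 : (j : ℝ) / 2 ^ n ≤ x := by rw [div_le_iff₀ hp]; linarith
    have e3 : ((j : ℝ) + 1) / 2 ^ n = j / 2 ^ n + 1 / 2 ^ n := by ring
    have g1 := mul_le_mul_of_nonneg_left e1 hc0
    have g2 := mul_le_mul_of_nonneg_left e2 hc0
    rw [e3, mul_add] at hi g1
    rw [abs_le]
    constructor <;> linarith
  have hlim : Tendsto (fun n : ℕ => c * (1 / 2 ^ n)) atTop (𝓝 0) := by
    have := (tendsto_pow_atTop_nhds_zero_of_lt_one (r := (1 / 2 : ℝ)) (by norm_num)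
      (by norm_num)).const_mul c
    simpa [one_div, inv_pow] using this
  have := ge_of_tendsto' hlim key
  have := abs_nonpos_iff.1 this
  linarith

/-- After normalising, every law on `ℝ` is the image of the uniform law on the unit interval. -/
theorem Halving.exists_map_eq {μ : Measure Ω} [IsFiniteMeasure μ] (h : Halving μ) (ν : Measure ℝ)
    (hν : ν Set.univ = μ Set.univ) : ∃ W : Ω → ℝ, Measurable W ∧ μ.map W = ν := by
  by_cases h0 : μ Set.univ = 0
  · refine ⟨fun _ => 0, measurable_const, ?_⟩
    rw [Measure.measure_univ_eq_zero.1 h0, Measure.map_zero]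
    exact (Measure.measure_univ_eq_zero.1 (hν.trans h0)).symm
  · obtain ⟨U, hUm, hU⟩ := h.exists_uniform
    have hp : IsProbabilityMeasure ((μ Set.univ)⁻¹ • ν) :=
      ⟨by rw [Measure.smul_apply, hν, smul_eq_mul,
        ENNReal.inv_mul_cancel h0 (measure_ne_top _ _)]⟩
    obtain ⟨f, hfm, hf⟩ := ((μ Set.univ)⁻¹ • ν).exists_measurable_map_eq
    refine ⟨f ∘ U, hfm.comp hUm, ?_⟩
    rw [← Measure.map_map hfm hUm, hU, Measure.map_smul, hf, smul_smul,
      ENNReal.mul_inv_cancel h0 (measure_ne_top _ _), one_smul]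

/-- On an atomless space, a pair `(U, W)` with countably valued `U` can be copied to a pair
`(V, W')` with prescribed first coordinate `V ~ U`. -/
theorem Halving.exists_coupling {Q : Measure Ω} [IsFiniteMeasure Q] (h : Halving Q)
    {U V : Ω → ℤ} {W : Ω → ℝ} (hU : Measurable U) (hV : Measurable V) (hW : Measurable W)
    (hUV : IdentDistrib U V Q Q) :
    ∃ W' : Ω → ℝ, Measurable W' ∧
      IdentDistrib (fun ω => (U ω, W ω)) (fun ω => (V ω, W' ω)) Q Q := by
  have hUs : ∀ k : ℤ, MeasurableSet (U ⁻¹' {k}) := fun k => hU (measurableSet_singleton k)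
  have hVs : ∀ k : ℤ, MeasurableSet (V ⁻¹' {k}) := fun k => hV (measurableSet_singleton k)
  -- On `V = k` the law that `W` has on `U = k` is realised afresh; the two events have equal mass
  -- because `U` and `V` have the same law. The pieces are then glued along `V`.
  have hk : ∀ k : ℤ, ∃ w : Ω → ℝ, Measurable w ∧
      (Q.restrict (V ⁻¹' {k})).map w = (Q.restrict (U ⁻¹' {k})).map W := by
    intro k
    refine (h.restrict (hVs k)).exists_map_eq _ ?_
    rw [Measure.map_apply hW MeasurableSet.univ]
    simpa using hUV.measure_mem_eq (measurableSet_singleton k)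
  choose w hwm hw using hk
  have hW'm : Measurable fun ω => w (V ω) ω :=
    measurable_from_prod_countable_right (f := fun p : ℤ × Ω => w p.1 p.2) hwm |>.comp
      (hV.prodMk measurable_id)
  refine ⟨fun ω => w (V ω) ω, hW'm, (hU.prodMk hW).aemeasurable, (hV.prodMk hW'm).aemeasurable, ?_⟩
  -- A joint law on `ℤ × ℝ` is the sum of its slices, so agreement slice by slice suffices.
  have aux : ∀ {X : Ω → ℤ} {Y : Ω → ℝ} (_ : Measurable X) (_ : Measurable Y) {s : Set (ℤ × ℝ)}
      (_ : MeasurableSet s), Q.map (fun ω => (X ω, Y ω)) s =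
        ∑' k : ℤ, (Q.restrict (X ⁻¹' {k})).map Y (Prod.mk k ⁻¹' s) := by
    intro X Y hX hY s hs
    rw [Measure.map_apply (hX.prodMk hY) hs]
    have : (fun ω => (X ω, Y ω)) ⁻¹' s = ⋃ k : ℤ, (Y ⁻¹' (Prod.mk k ⁻¹' s) ∩ X ⁻¹' {k}) := by
      ext ω; simp
    rw [this, measure_iUnion]
    · refine tsum_congr fun k => ?_
      have hs' := measurable_prodMk_left (x := k) hs
      rw [Measure.map_apply hY hs', Measure.restrict_apply (hY hs')]
    · intro i j hij
      rw [Function.onFun, Set.disjoint_left]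
      rintro ω ⟨_, h1⟩ ⟨_, h2⟩
      exact hij (h1.symm.trans h2)
    · intro k
      exact (hY (measurable_prodMk_left hs)).inter (hX (measurableSet_singleton k))
  ext s hs
  rw [aux hU hW hs, aux hV hW'm hs]
  refine tsum_congr fun k => ?_
  rw [← hw k]
  refine congrFun (congrArg _ (Measure.map_congr ?_)) _
  filter_upwards [ae_restrict_mem (hVs k)] with ω hω
  have : V ω = k := hω
  simp [this]

end Coupling

/-! ### Rearranging one factor of an integral -/

section Coupling

variable {Ω : Type*} {m : MeasurableSpace Ω}

theorem abs_sub_mul_floor_div_le {δ : ℝ} (hδ : 0 < δ) (x : ℝ) : |x - δ * ⌊x / δ⌋| ≤ δ := by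
  have h1 : (⌊x / δ⌋ : ℝ) ≤ x / δ := Int.floor_le _
  have h2 : x / δ < ⌊x / δ⌋ + 1 := Int.lt_floor_add_one _
  rw [le_div_iff₀ hδ] at h1
  rw [div_lt_iff₀ hδ] at h2
  rw [abs_le]
  constructor <;> nlinarith

/-- The difference of the two products is a bounded function times `w`. Integrability can thus pass
from `f w` to `g w'` through the discretised products, which share a law. -/
theorem integrable_mul_iff_floor {Q : Measure Ω} {f w : Ω → ℝ} (hf : AEMeasurable f Q)
    (hw : Integrable w Q) {δ : ℝ} (hδ : 0 < δ) :
    Integrable (fun ω => f ω * w ω) Q ↔ Integrable (fun ω => δ * ⌊f ω / δ⌋ * w ω) Q := by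
  have hd : Integrable (fun ω => (f ω - δ * ⌊f ω / δ⌋) * w ω) Q := by
    refine Integrable.bdd_mul (c := δ) hw ?_ (ae_of_all _ fun ω => abs_sub_mul_floor_div_le hδ _)
    have : Measurable fun x : ℝ => x - δ * ⌊x / δ⌋ := by fun_prop
    exact (this.comp_aemeasurable hf).aestronglyMeasurable
  constructor
  · intro h
    refine (h.sub hd).congr (ae_of_all _ fun ω => ?_)
    simp only [Pi.sub_apply]; ring
  · intro h
    refine (h.add hd).congr (ae_of_all _ fun ω => ?_)
    simp only [Pi.add_apply]; ring

theorem abs_integral_mul_sub_floor_le {Q : Measure Ω} {f w : Ω → ℝ}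
    (hw : Integrable w Q) {δ : ℝ} (hδ : 0 < δ) (hfw : Integrable (fun ω => f ω * w ω) Q)
    (hfw' : Integrable (fun ω => δ * ⌊f ω / δ⌋ * w ω) Q) :
    |∫ ω, f ω * w ω ∂Q - ∫ ω, δ * ⌊f ω / δ⌋ * w ω ∂Q| ≤ δ * ∫ ω, |w ω| ∂Q := by
  rw [← integral_sub hfw hfw', ← integral_const_mul]
  refine (abs_integral_le_integral_abs).trans (integral_mono ((hfw.sub hfw').abs)
    (hw.abs.const_mul δ) fun ω => ?_)
  simp only
  rw [← sub_mul, abs_mul]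
  exact mul_le_mul_of_nonneg_right (abs_sub_mul_floor_div_le hδ _) (abs_nonneg _)

/-- On an atomless space, if `f ~ g` then for any `w` there is `w' ~ w` such that `∫ g w'` is
arbitrarily close to `∫ f w`. -/
theorem Halving.exists_identDistrib_integral_mul {Q : Measure Ω} [IsFiniteMeasure Q]
    (h : Halving Q) {f g w : Ω → ℝ} (hfg : IdentDistrib f g Q Q) (hw : Integrable w Q)
    (hfw : Integrable (fun ω => f ω * w ω) Q) {ε : ℝ} (hε : 0 < ε) :
    ∃ w' : Ω → ℝ, Measurable w' ∧ IdentDistrib w w' Q Q ∧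
      |∫ ω, g ω * w' ω ∂Q - ∫ ω, f ω * w ω ∂Q| ≤ ε := by
  set K := ∫ ω, |w ω| ∂Q with hK
  have hK0 : 0 ≤ K := integral_nonneg fun ω => abs_nonneg _
  -- Discretisation costs at most `δ * K` on each side; the `+ 1` keeps the denominator positive
  -- when `K = 0`.
  set δ := ε / (2 * K + 1) with hδdef
  have hδ : 0 < δ := by positivity
  have hfl : Measurable fun x : ℝ => ⌊x / δ⌋ := by fun_prop
  have hf := hfg.aemeasurable_fst
  have hg := hfg.aemeasurable_snd
  have hff : IdentDistrib (hf.mk f) (hg.mk g) Q Q :=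
    hf.identDistrib_mk.symm.trans (hfg.trans hg.identDistrib_mk)
  have hwm := hw.aemeasurable
  -- Only the discretised `f` and `g` are coupled exactly: their level sets retain the randomness
  -- needed to copy `w`.
  obtain ⟨w', hw'm, hw'⟩ := h.exists_coupling (U := fun ω => ⌊hf.mk f ω / δ⌋)
    (V := fun ω => ⌊hg.mk g ω / δ⌋) (hfl.comp hf.measurable_mk)
    (hfl.comp hg.measurable_mk) hwm.measurable_mk (hff.comp hfl)
  have hww' : IdentDistrib w w' Q Q := hwm.identDistrib_mk.trans (hw'.comp measurable_snd)
  have hprod : Measurable fun p : ℤ × ℝ => δ * p.1 * p.2 := by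
    have : Measurable fun n : ℤ => (n : ℝ) := measurable_from_top
    fun_prop
  have hmk : IdentDistrib (fun ω => δ * ⌊hf.mk f ω / δ⌋ * hwm.mk w ω)
    (fun ω => δ * ⌊hg.mk g ω / δ⌋ * w' ω) Q Q := hw'.comp hprod
  have hid1 : (fun ω => δ * ⌊f ω / δ⌋ * w ω)
      =ᵐ[Q] fun ω => δ * ⌊hf.mk f ω / δ⌋ * hwm.mk w ω := by
    filter_upwards [hf.ae_eq_mk, hwm.ae_eq_mk] with ω h1 h2
    rw [h1, h2]
  have hid2 : (fun ω => δ * ⌊hg.mk g ω / δ⌋ * w' ω)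
      =ᵐ[Q] fun ω => δ * ⌊g ω / δ⌋ * w' ω := by
    filter_upwards [hg.ae_eq_mk] with ω h1
    rw [h1]
  have hid : IdentDistrib (fun ω => δ * ⌊f ω / δ⌋ * w ω) (fun ω => δ * ⌊g ω / δ⌋ * w' ω) Q Q :=
    (IdentDistrib.of_ae_eq hmk.aemeasurable_fst hid1.symm).symm.trans
      (hmk.trans (IdentDistrib.of_ae_eq hmk.aemeasurable_snd hid2))
  refine ⟨w', hw'm, hww', ?_⟩
  have hw'i : Integrable w' Q := hww'.integrable_snd hw
  have hfw1 := (integrable_mul_iff_floor hf hw hδ).1 hfw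
  have hgw1 := hid.integrable_snd hfw1
  have hgw := (integrable_mul_iff_floor hg hw'i hδ).2 hgw1
  have e1 := abs_integral_mul_sub_floor_le hw hδ hfw hfw1
  have e2 := abs_integral_mul_sub_floor_le hw'i hδ hgw hgw1
  have e3 := hid.integral_eq
  have e4 : ∫ ω, |w' ω| ∂Q = K := (hww'.comp measurable_norm).integral_eq.symm
  rw [e4] at e2
  have e5 : 2 * (δ * K) ≤ ε := by
    rw [hδdef, div_mul_eq_mul_div, mul_div_assoc', div_le_iff₀ (by positivity)]
    nlinarith
  rw [abs_le] at *
  constructor <;> linarith [e1.1, e1.2, e2.1, e2.2]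

end Coupling

/-! ### Densities and the dual pairing -/

section Density

variable {Ω : Type*} {m : MeasurableSpace Ω} {Q : Measure Ω}

theorem density_ae_eq (μ : ACSigned Q) : density μ =ᵐ[Q] (μ : SignedMeasure Ω).rnDeriv Q :=
  AEEqFun.coeFn_mk _ _

theorem integrable_density (μ : ACSigned Q) : Integrable (density μ) Q :=
  (SignedMeasure.integrable_rnDeriv _ _).congr (density_ae_eq μ).symm

theorem withDensity_density [SigmaFinite Q] (μ : ACSigned Q) :
    Q.withDensityᵥ (density μ) = (μ : SignedMeasure Ω) := by
  rw [WithDensityᵥEq.congr_ae (density_ae_eq μ)]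
  exact (SignedMeasure.absolutelyContinuous_iff_withDensityᵥ_rnDeriv_eq _ _).1 μ.2

theorem setIntegral_density [SigmaFinite Q] (μ : ACSigned Q) {s : Set Ω} (hs : MeasurableSet s) :
    ∫ ω in s, density μ ω ∂Q = (μ : SignedMeasure Ω) s := by
  rw [← withDensityᵥ_apply (integrable_density μ) hs, withDensity_density]

theorem density_unique [SigmaFinite Q] (μ : ACSigned Q) {f : Ω → ℝ} (hf : Integrable f Q)
    (h : ∀ s, MeasurableSet s → ∫ ω in s, f ω ∂Q = (μ : SignedMeasure Ω) s) :
    density μ =ᵐ[Q] f :=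
  (integrable_density μ).ae_eq_of_forall_setIntegral_eq _ _ hf fun s hs _ => by
    rw [h s hs, setIntegral_density μ hs]

/-- The signed measure with a given integrable density. -/
def ofDensity (f : Ω → ℝ) : ACSigned Q :=
  ⟨Q.withDensityᵥ f, Measure.withDensityᵥ_absolutelyContinuous Q f⟩

theorem density_ofDensity [SigmaFinite Q] {f : Ω → ℝ} (hf : Integrable f Q) :
    density (ofDensity f : ACSigned Q) =ᵐ[Q] f :=
  density_unique _ hf fun _ hs => (withDensityᵥ_apply hf hs).symm

theorem density_add [SigmaFinite Q] (μ ν : ACSigned Q) :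
    density (μ + ν) =ᵐ[Q] fun ω => density μ ω + density ν ω := by
  refine density_unique _ ((integrable_density μ).add (integrable_density ν)) fun s hs => ?_
  rw [integral_add (integrable_density μ).integrableOn (integrable_density ν).integrableOn,
    setIntegral_density μ hs, setIntegral_density ν hs]
  rfl

theorem density_smul [SigmaFinite Q] (c : ℝ) (μ : ACSigned Q) :
    density (c • μ) =ᵐ[Q] fun ω => c * density μ ω := by
  refine density_unique _ ((integrable_density μ).const_mul c) fun s hs => ?_
  rw [integral_const_mul, setIntegral_density μ hs]
  rfl

theorem LInf.bound (X : LInf Q) : ∀ᵐ ω ∂Q, |X ω| ≤ ‖X‖ := by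
  have := ae_le_eLpNormEssSup (f := X) (μ := Q)
  filter_upwards [this] with ω hω
  rw [Lp.norm_def, eLpNorm_exponent_top]
  have h2 := ENNReal.toReal_mono (by
    rw [← eLpNorm_exponent_top]; exact (Lp.eLpNorm_ne_top X)) hω
  simpa using h2

theorem integrable_density_mul (μ : ACSigned Q) (X : LInf Q) :
    Integrable (fun ω => density μ ω * X ω) Q := by
  refine Integrable.mul_bdd (c := ‖X‖) (integrable_density μ)
    (Lp.aestronglyMeasurable X) ?_
  simpa using LInf.bound X

theorem expect_congr (μ : ACSigned Q) (X : LInf Q) {f g : Ω → ℝ} (hf : density μ =ᵐ[Q] f)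
    (hg : X =ᵐ[Q] g) : expect μ X = ∫ ω, f ω * g ω ∂Q :=
  integral_congr_ae (hf.mul hg)

theorem expect_add_left [SigmaFinite Q] (μ ν : ACSigned Q) (X : LInf Q) :
    expect (μ + ν) X = expect μ X + expect ν X := by
  rw [expect_congr _ X (density_add μ ν) EventuallyEq.rfl, expect, expect,
    ← integral_add (integrable_density_mul μ X) (integrable_density_mul ν X)]
  simp_rw [add_mul]

theorem expect_smul_left [SigmaFinite Q] (c : ℝ) (μ : ACSigned Q) (X : LInf Q) :
    expect (c • μ) X = c * expect μ X := by
  rw [expect_congr _ X (density_smul c μ) EventuallyEq.rfl, expect, ← integral_const_mul]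
  simp_rw [mul_assoc]

theorem expect_add_right (μ : ACSigned Q) (X Y : LInf Q) :
    expect μ (X + Y) = expect μ X + expect μ Y := by
  rw [expect_congr μ (X + Y) EventuallyEq.rfl (Lp.coeFn_add X Y), expect, expect,
    ← integral_add (integrable_density_mul μ X) (integrable_density_mul μ Y)]
  simp_rw [Pi.add_apply, mul_add]

theorem expect_smul_right (μ : ACSigned Q) (c : ℝ) (X : LInf Q) :
    expect μ (c • X) = c * expect μ X := by
  rw [expect_congr μ (c • X) EventuallyEq.rfl (Lp.coeFn_smul c X), expect, ← integral_const_mul]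
  simp_rw [Pi.smul_apply, smul_eq_mul, mul_left_comm]

theorem expect_const [IsFiniteMeasure Q] (μ : ACSigned Q) (c : ℝ) :
    expect μ (Lp.const ∞ Q c) = c * (μ : SignedMeasure Ω) Set.univ := by
  rw [expect_congr μ _ EventuallyEq.rfl (Lp.coeFn_const ∞ Q c)]
  simp only [Function.const_apply]
  rw [integral_mul_const, ← setIntegral_univ, setIntegral_density μ MeasurableSet.univ, mul_comm]

theorem density_nonneg [SigmaFinite Q] {μ : ACSigned Q} (h : 0 ≤ (μ : SignedMeasure Ω)) :
    0 ≤ᵐ[Q] density μ := by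
  refine ae_nonneg_of_forall_setIntegral_nonneg (integrable_density μ) fun s hs _ => ?_
  rw [setIntegral_density μ hs]
  exact h s hs

theorem expect_mono [SigmaFinite Q] {μ : ACSigned Q} (h : 0 ≤ (μ : SignedMeasure Ω)) {X Y : LInf Q}
    (hXY : X ≤ Y) : expect μ X ≤ expect μ Y := by
  refine integral_mono_ae (integrable_density_mul μ X) (integrable_density_mul μ Y) ?_
  filter_upwards [density_nonneg h, (Lp.coeFn_le X Y).2 hXY] with ω h1 h2
  exact mul_le_mul_of_nonneg_left h2 h1

/-- `E^μ` is continuous along uniformly bounded a.s. convergent sequences. -/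
theorem tendsto_expect (μ : ACSigned Q) {Xs : ℕ → LInf Q} {X : LInf Q} {C : ℝ}
    (hC : ∀ n, ‖Xs n‖ ≤ C) (hX : ∀ᵐ ω ∂Q, Tendsto (fun n => Xs n ω) atTop (𝓝 (X ω))) :
    Tendsto (fun n => expect μ (Xs n)) atTop (𝓝 (expect μ X)) := by
  refine tendsto_integral_of_dominated_convergence (fun ω => |density μ ω| * C)
    (fun n => (integrable_density_mul μ (Xs n)).aestronglyMeasurable)
    ((integrable_density μ).abs.mul_const C) (fun n => ?_) ?_
  · filter_upwards [LInf.bound (Xs n)] with ω hω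
    rw [Real.norm_eq_abs, abs_mul]
    exact mul_le_mul_of_nonneg_left (hω.trans (hC n)) (abs_nonneg _)
  · filter_upwards [hX] with ω hω
    exact hω.const_mul _

end Density

/-! ### Restriction to a sub-σ-algebra -/

section Restriction

variable {Ω : Type*} {𝒢 mΩ : MeasurableSpace Ω} {P : Measure[mΩ] Ω} [IsFiniteMeasure P]

/-- Both sides are `𝒢`-measurable with the same integrals over the sets of `𝒢`. -/
theorem density_restrictSub (h𝒢 : 𝒢 ≤ mΩ) (μ : ACSigned P) :
    density (restrictSub h𝒢 μ) =ᵐ[P] P[density μ | 𝒢] := by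
  have h1 : Integrable (P[density μ | 𝒢]) (P.trim h𝒢) :=
    integrable_condExp.trim h𝒢 stronglyMeasurable_condExp
  refine ae_eq_of_ae_eq_trim (hm := h𝒢) (density_unique _ h1 fun s hs => ?_)
  rw [← setIntegral_trim h𝒢 stronglyMeasurable_condExp hs,
    setIntegral_condExp h𝒢 (integrable_density μ) hs, setIntegral_density μ (h𝒢 s hs)]
  exact (VectorMeasure.trim_measurableSet_eq h𝒢 hs).symm

/-- A `𝒢`-measurable `X` can be pulled out of the conditional expectation of `density μ * X`. -/
theorem expect_restrictSub (h𝒢 : 𝒢 ≤ mΩ) (μ : ACSigned P) {X' : LInf (P.trim h𝒢)} {X : LInf P}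
    (h : X' =ᵐ[P] X) : expect (restrictSub h𝒢 μ) X' = expect μ X := by
  have hX : AEStronglyMeasurable[𝒢] X P :=
    (AEStronglyMeasurable.congr (m := 𝒢)
      ((Lp.stronglyMeasurable X').aestronglyMeasurable) h)
  rw [expect, ← integral_trim_ae h𝒢
    (integrable_density_mul (restrictSub h𝒢 μ) X').aestronglyMeasurable]
  have h1 : P[fun ω => density μ ω * X ω | 𝒢] =ᵐ[P] P[density μ | 𝒢] * X :=
    condExp_mul_of_aestronglyMeasurable_right hX (integrable_density_mul μ X)
      (integrable_density μ)
  rw [expect, ← integral_condExp h𝒢 (f := fun ω => density μ ω * X ω), integral_congr_ae h1]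
  exact integral_congr_ae ((density_restrictSub h𝒢 μ).mul h)

end Restriction

/-! ### Separation in a weaker Hilbert norm -/

section Hilbert

variable {H : Type*} [NormedAddCommGroup H] [InnerProductSpace ℝ H] [CompleteSpace H]

/-- Nested nonempty bounded closed convex sets of a Hilbert space have a common point. -/
theorem nonempty_iInter_of_convex {C : ℕ → Set H} (hanti : Antitone C)
    (hne : ∀ n, (C n).Nonempty) (hcl : ∀ n, IsClosed (C n)) (hcv : ∀ n, Convex ℝ (C n)) {M : ℝ}
    (hM : ∀ n, ∀ x ∈ C n, ‖x‖ ≤ M) : (⋂ n, C n).Nonempty := by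
  have hmin : ∀ n, ∃ x ∈ C n, ∀ y ∈ C n, ‖x‖ ≤ ‖y‖ := by
    intro n
    obtain ⟨x, hx, h⟩ := exists_norm_eq_iInf_of_complete_convex (hne n) (hcl n).isComplete
      (hcv n) 0
    refine ⟨x, hx, fun y hy => ?_⟩
    have h2 : ⨅ w : C n, ‖(0 : H) - w‖ ≤ ‖(0 : H) - (⟨y, hy⟩ : C n)‖ :=
      ciInf_le ⟨0, Set.forall_mem_range.2 fun _ => norm_nonneg _⟩ _
    rw [← h] at h2
    simpa using h2
  choose x hx hxmin using hmin
  -- The midpoint of the minimal-norm points lies in `C n`, so its norm is at least `‖x n‖`; the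
  -- parallelogram law turns this into a Cauchy estimate.
  have hpar : ∀ n k, n ≤ k → ‖x n - x k‖ ^ 2 ≤ 2 * (‖x k‖ ^ 2 - ‖x n‖ ^ 2) := by
    intro n k hnk
    have hmid : (1 / 2 : ℝ) • x n + (1 / 2 : ℝ) • x k ∈ C n :=
      hcv n (hx n) (hanti hnk (hx k)) (by norm_num) (by norm_num) (by norm_num)
    have h1 := hxmin n _ hmid
    rw [← smul_add, norm_smul] at h1
    have h2 := parallelogram_law_with_norm ℝ (x n) (x k)
    norm_num at h1
    nlinarith [norm_nonneg (x n), norm_nonneg (x n + x k)]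
  have hmono : Monotone fun n => ‖x n‖ ^ 2 := by
    intro n k hnk
    nlinarith [hpar n k hnk, sq_nonneg ‖x n - x k‖]
  have hbdd : BddAbove (Set.range fun n => ‖x n‖ ^ 2) :=
    ⟨M ^ 2, Set.forall_mem_range.2 fun n => pow_le_pow_left₀ (norm_nonneg _) (hM n _ (hx n)) 2⟩
  set L := ⨆ n, ‖x n‖ ^ 2
  have hL : ∀ n, ‖x n‖ ^ 2 ≤ L := le_ciSup hbdd
  have hlim : Tendsto (fun n => Real.sqrt (2 * (L - ‖x n‖ ^ 2))) atTop (𝓝 0) := by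
    have := (((tendsto_atTop_ciSup hmono hbdd).const_sub L).const_mul 2).sqrt
    simpa [L] using this
  have hcau : CauchySeq x := by
    refine cauchySeq_of_le_tendsto_0' _ (fun n k hnk => ?_) hlim
    rw [dist_eq_norm]
    refine Real.le_sqrt_of_sq_le ((hpar n k hnk).trans ?_)
    linarith [hL k]
  obtain ⟨y, hy⟩ := cauchySeq_tendsto_of_complete hcau
  refine ⟨y, Set.mem_iInter.2 fun n => (hcl n).mem_of_tendsto hy ?_⟩
  filter_upwards [eventually_ge_atTop n] with k hk
  exact hanti hk (hx k)

variable {E : Type*} [NormedAddCommGroup E] [NormedSpace ℝ E]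

/-- Krein–Šmulian type separation: a convex set whose bounded parts are closed in a weaker Hilbert
norm and which misses the origin is strictly separated from the origin by a functional
that is continuous for the Hilbert norm on bounded sets. -/
theorem exists_separating_functional (i : E →L[ℝ] H) (hi : Function.Injective i) {C : Set E}
    (hC : Convex ℝ C) (hC0 : (0 : E) ∉ C)
    (hball : ∀ n : ℕ, IsClosed (i '' Metric.closedBall 0 n))
    (hCcl : ∀ n : ℕ, IsClosed (i '' (C ∩ Metric.closedBall 0 n))) :
    ∃ (f : E →L[ℝ] ℝ) (u : ℝ), 0 < u ∧ (∀ x ∈ C, u ≤ f x) ∧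
      ∀ (M : ℝ) (x : ℕ → E), (∀ k, ‖x k‖ ≤ M) → Tendsto (fun k => i (x k)) atTop (𝓝 0) →
        Tendsto (fun k => f (x k)) atTop (𝓝 0) := by
  set B : ℕ → Set H := fun n => i '' Metric.closedBall 0 n with hB
  have hBcv : ∀ n, Convex ℝ (B n) := fun n => (convex_closedBall _ _).linear_image i.toLinearMap
  have h0B : ∀ n, (0 : H) ∈ B n := fun n => ⟨0, by simp, map_zero i⟩
  -- If every `δ` failed, the nested sets for `δ = 1 / (k + 1)` would have a common point. It would
  -- lie in the closed set `B n`, contradicting the disjointness at level `n`.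
  have step : ∀ (n : ℕ) (G : Set H), IsClosed G → Convex ℝ G →
      i '' (C ∩ Metric.closedBall 0 n) ∩ G = ∅ → ∃ δ : ℝ, 0 < δ ∧
        i '' (C ∩ Metric.closedBall 0 (n + 1 : ℕ)) ∩ (G ∩ Metric.cthickening δ (B n)) = ∅ := by
    intro n G hGcl hGcv hdisj
    by_contra! hcon
    let D : ℕ → Set H := fun k => i '' (C ∩ Metric.closedBall 0 (n + 1 : ℕ)) ∩
      (G ∩ Metric.cthickening (1 / ((k : ℝ) + 1)) (B n))
    obtain ⟨y, hy⟩ := nonempty_iInter_of_convex (C := D) (M := ‖i‖ * (n + 1 : ℕ)) (by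
        intro k l hkl
        refine Set.inter_subset_inter_right _ (Set.inter_subset_inter_right _
          (Metric.cthickening_mono ?_ _))
        gcongr)
      (fun k => hcon _ (by positivity))
      (fun k => (hCcl _).inter (hGcl.inter Metric.isClosed_cthickening))
      (fun k => ((hC.inter (convex_closedBall _ _)).linear_image i.toLinearMap).inter
        (hGcv.inter ((hBcv n).cthickening _)))
      (by
        rintro k _ ⟨⟨x, ⟨_, hx⟩, rfl⟩, _⟩
        rw [mem_closedBall_zero_iff] at hx
        exact (i.le_opNorm x).trans (by gcongr))
    rw [Set.mem_iInter] at hy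
    obtain ⟨⟨x, ⟨hxC, hx⟩, rfl⟩, hxG, _⟩ := hy 0
    have hmem : i x ∈ B n := by
      have : i x ∈ closure (B n) := by
        rw [Metric.mem_closure_iff_infDist_zero ⟨0, h0B n⟩]
        refine le_antisymm (ge_of_tendsto' tendsto_one_div_add_atTop_nhds_zero_nat fun k => ?_)
          Metric.infDist_nonneg
        refine ENNReal.toReal_le_of_le_ofReal (by positivity) ?_
        exact Metric.mem_cthickening_iff.1 (hy k).2.2
      rwa [(hball n).closure_eq] at this
    obtain ⟨x', hx', hxx'⟩ := hmem
    obtain rfl := hi hxx'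
    have : i x' ∈ i '' (C ∩ Metric.closedBall 0 n) ∩ G := ⟨⟨x', ⟨hxC, hx'⟩, rfl⟩, hxG⟩
    rw [hdisj] at this
    exact this
  choose! δ hδ0 hδ using step
  let G : ℕ → Set H := fun n =>
    Nat.rec Set.univ (fun n G => G ∩ Metric.cthickening (δ n G) (B n)) n
  have hGs : ∀ n, G (n + 1) = G n ∩ Metric.cthickening (δ n (G n)) (B n) := fun n => rfl
  have hG : ∀ n, IsClosed (G n) ∧ Convex ℝ (G n) ∧
      i '' (C ∩ Metric.closedBall 0 n) ∩ G n = ∅ := by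
    intro n
    induction n with
    | zero =>
      refine ⟨isClosed_univ, convex_univ, ?_⟩
      rw [Set.eq_empty_iff_forall_notMem]
      rintro _ ⟨⟨x, ⟨hxC, hx⟩, rfl⟩, _⟩
      simp only [Nat.cast_zero, Metric.closedBall_zero, Set.mem_singleton_iff] at hx
      exact hC0 (hx ▸ hxC)
    | succ n ih =>
      obtain ⟨h1, h2, h3⟩ := ih
      rw [hGs]
      exact ⟨h1.inter Metric.isClosed_cthickening, h2.inter ((hBcv n).cthickening _),
        hδ n _ h1 h2 h3⟩
  have hδpos : ∀ n, 0 < δ n (G n) := fun n => hδ0 n _ (hG n).1 (hG n).2.1 (hG n).2.2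
  have hmemG : ∀ y, (∀ j, y ∈ Metric.cthickening (δ j (G j)) (B j)) → ∀ n, y ∈ G n := by
    intro y hy n
    induction n with
    | zero => trivial
    | succ n ih => exact ⟨ih, hy n⟩
  -- A convex neighbourhood of `0` that misses `C` and is large enough to control bounded sequences
  -- that are null in `H`.
  set U : Set E := i ⁻¹' ⋂ n, G n with hU
  have hUcv : Convex ℝ U := (convex_iInter fun n => (hG n).2.1).linear_preimage i.toLinearMap
  have hUC : Disjoint U C := by
    rw [Set.disjoint_left]
    intro x hxU hxC
    obtain ⟨n, hn⟩ := exists_nat_ge ‖x‖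
    have : i x ∈ i '' (C ∩ Metric.closedBall 0 n) ∩ G n :=
      ⟨⟨x, ⟨hxC, by simpa using hn⟩, rfl⟩, Set.mem_iInter.1 hxU n⟩
    rw [(hG n).2.2] at this
    exact this
  -- For `‖x‖ ≤ M ≤ N` the conditions with `j ≥ N` hold since `i x ∈ B j`; only finitely many
  -- thickenings remain.
  have hev : ∀ (l : Filter E) (M : ℝ), (∀ᶠ x in l, ‖x‖ ≤ M) → Tendsto i l (𝓝 0) →
      ∀ᶠ x in l, x ∈ U := by
    intro l M hM hx
    obtain ⟨N, hN⟩ := exists_nat_ge M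
    have h1 : ∀ᶠ x in l, ∀ j ∈ Finset.range N, ‖i x‖ ≤ δ j (G j) := by
      rw [Filter.eventually_all_finset]
      intro j _
      have := hx.norm.eventually (eventually_le_nhds (b := δ j (G j)) (by simpa using hδpos j))
      simpa using this
    filter_upwards [hM, h1] with x hx1 hx2
    refine Set.mem_iInter.2 (hmemG _ fun j => ?_)
    by_cases hj : j < N
    · refine Metric.mem_cthickening_of_dist_le _ 0 _ _ (h0B j) ?_
      simpa using hx2 j (Finset.mem_range.2 hj)
    · refine Metric.self_subset_cthickening _ ⟨x, ?_, rfl⟩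
      rw [mem_closedBall_zero_iff]
      refine hx1.trans (hN.trans ?_)
      exact_mod_cast not_lt.1 hj
  have h0 : (0 : E) ∈ interior U := by
    rw [mem_interior_iff_mem_nhds]
    refine hev (𝓝 0) 1 ?_ ?_
    · filter_upwards [Metric.closedBall_mem_nhds (0 : E) one_pos] with x hx
      simpa using hx
    · simpa using i.continuous.tendsto 0
  obtain ⟨f, u, hf1, hf2⟩ := geometric_hahn_banach_open hUcv.interior isOpen_interior hC
    (hUC.mono_left interior_subset)
  have hu : 0 < u := by simpa using hf1 0 h0
  have hfU : ∀ x ∈ U, f x ≤ u := by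
    intro x hx
    have h1 : x ∈ closure (interior U) := by
      rw [hUcv.closure_interior_eq_closure_of_nonempty_interior ⟨0, h0⟩]
      exact subset_closure hx
    exact closure_minimal (fun y hy => (hf1 y hy).le) (isClosed_le f.continuous continuous_const) h1
  refine ⟨f, u, hu, hf2, fun M x hM hx => ?_⟩
  -- Multiples by `c` and `-c` are eventually in `U`, where `f ≤ u`; hence `|f (x k)| ≤ u / c = ε /
  -- 2`.
  rw [Metric.tendsto_nhds]
  intro ε hε
  set c := 2 * u / ε with hc
  have hc0 : 0 < c := by positivity
  have hsc : ∀ a : ℝ, ∀ᶠ k in atTop, a • x k ∈ U := by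
    intro a
    refine hev (map (fun k => a • x k) atTop) (|a| * M)
      (eventually_map.2 (Eventually.of_forall fun k => ?_)) (tendsto_map'_iff.2 ?_)
    · rw [norm_smul, Real.norm_eq_abs]
      exact mul_le_mul_of_nonneg_left (hM k) (abs_nonneg _)
    · simpa [Function.comp_def] using hx.const_smul a
  filter_upwards [hsc c, hsc (-c)] with k h1 h2
  have g1 := hfU _ h1
  have g2 := hfU _ h2
  rw [map_smul, smul_eq_mul] at g1 g2
  have hcu : c * ε = 2 * u := by rw [hc]; field_simp
  rw [dist_zero_right, Real.norm_eq_abs, abs_lt]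
  constructor <;> nlinarith

end Hilbert

/-! ### The inclusion of `L^∞` into `L²` -/

section Inclusion

variable {Ω : Type*} {m : MeasurableSpace Ω} {P : Measure Ω} [IsProbabilityMeasure P]

theorem Lp_norm_le_of_ae_abs_le {p : ℝ≥0∞} {X : Lp ℝ p P} {C : ℝ} (hC : 0 ≤ C)
    (h : ∀ᵐ ω ∂P, |X ω| ≤ C) : ‖X‖ ≤ C := by
  have := Lp.norm_le_of_ae_bound (f := X) hC h
  simpa [measureUnivNNReal] using this

variable (P) in
/-- The inclusion `L^∞ → L²`. -/
def toLtwo : LInf P →L[ℝ] Lp ℝ 2 P :=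
  LinearMap.mkContinuous
    { toFun := fun X => ((Lp.memLp X).mono_exponent le_top : MemLp X 2 P).toLp X
      map_add' := fun X Y => by
        rw [← MemLp.toLp_add]
        exact MemLp.toLp_congr _ _ (Lp.coeFn_add X Y)
      map_smul' := fun c X => by
        rw [RingHom.id_apply, ← MemLp.toLp_const_smul]
        exact MemLp.toLp_congr _ _ (Lp.coeFn_smul c X) } 1 fun X => by
    rw [one_mul]
    refine Lp_norm_le_of_ae_abs_le (norm_nonneg _) ?_
    have hX : MemLp X 2 P := (Lp.memLp X).mono_exponent le_top
    filter_upwards [LInf.bound X, hX.coeFn_toLp] with ω h1 h2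
    exact h2 ▸ h1

theorem coeFn_toLtwo (X : LInf P) : toLtwo P X =ᵐ[P] X :=
  MemLp.coeFn_toLp ((Lp.memLp X).mono_exponent le_top)

theorem toLtwo_injective : Function.Injective (toLtwo P) := by
  intro X Y h
  refine Lp.ext ((coeFn_toLtwo X).symm.trans ?_)
  rw [h]
  exact coeFn_toLtwo Y

theorem tendsto_toLtwo_zero {Xs : ℕ → LInf P} {C : ℝ} (hC : ∀ n, ‖Xs n‖ ≤ C)
    (hX : ∀ᵐ ω ∂P, Tendsto (fun n => Xs n ω) atTop (𝓝 0)) :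
    Tendsto (fun n => toLtwo P (Xs n)) atTop (𝓝 0) := by
  have hsq : ∀ n, ‖toLtwo P (Xs n)‖ ^ 2 = ∫ ω, Xs n ω * Xs n ω ∂P := by
    intro n
    rw [← real_inner_self_eq_norm_sq, L2.inner_def]
    refine integral_congr_ae ?_
    filter_upwards [coeFn_toLtwo (Xs n)] with ω h
    simp [h, sq]
  have hint : Tendsto (fun n => ∫ ω, Xs n ω * Xs n ω ∂P) atTop (𝓝 (∫ _, (0 : ℝ) ∂P)) := by
    refine tendsto_integral_of_dominated_convergence (fun _ => C * C)
      (fun n => (Lp.aestronglyMeasurable _).mul (Lp.aestronglyMeasurable _))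
      (integrable_const _) (fun n => ?_) ?_
    · filter_upwards [LInf.bound (Xs n)] with ω h
      rw [Real.norm_eq_abs, abs_mul]
      exact mul_self_le_mul_self (abs_nonneg _) (h.trans (hC n))
    · filter_upwards [hX] with ω h
      simpa using h.mul h
  rw [tendsto_zero_iff_norm_tendsto_zero]
  have := hint.sqrt
  simp_rw [← hsq, Real.sqrt_sq (norm_nonneg _)] at this
  simpa using this

/-- An `L²`-convergent sequence has an a.s. convergent subsequence, and the uniform bound passes to
the limit. This is what lets the Fatou property yield `L²`-closedness. -/
theorem isClosed_toLtwo_image {S : Set (LInf P)} {r : ℝ} (hS : S ⊆ Metric.closedBall 0 r)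
    (hcl : ∀ (Xs : ℕ → LInf P) (X : LInf P), (∀ n, Xs n ∈ S) → ‖X‖ ≤ r →
      (∀ᵐ ω ∂P, Tendsto (fun n => Xs n ω) atTop (𝓝 (X ω))) → X ∈ S) :
    IsClosed (toLtwo P '' S) := by
  refine IsSeqClosed.isClosed fun y z hy hyz => ?_
  choose x hxS hx using hy
  have hxr : ∀ n, ‖x n‖ ≤ r := fun n => mem_closedBall_zero_iff.1 (hS (hxS n))
  obtain ⟨ns, -, hns⟩ := (tendstoInMeasure_of_tendsto_Lp hyz).exists_seq_tendsto_ae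
  have hxy : ∀ᵐ ω ∂P, ∀ n, y n ω = x n ω :=
    ae_all_iff.2 fun n => by rw [← hx n]; exact coeFn_toLtwo (x n)
  have hxz : ∀ᵐ ω ∂P, Tendsto (fun n => x (ns n) ω) atTop (𝓝 (z ω)) := by
    filter_upwards [hns, hxy] with ω h1 h2
    simpa only [h2] using h1
  have hzr : ∀ᵐ ω ∂P, |z ω| ≤ r := by
    filter_upwards [hxz, ae_all_iff.2 fun n => LInf.bound (x n)] with ω h1 h2
    exact le_of_tendsto' h1.abs fun n => (h2 _).trans (hxr _)
  have hzm : MemLp z ∞ P := memLp_top_of_bound (Lp.aestronglyMeasurable z) r hzr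
  refine ⟨hzm.toLp z, ?_, ?_⟩
  · refine hcl (fun n => x (ns n)) _ (fun n => hxS _) ?_ ?_
    · refine Lp_norm_le_of_ae_abs_le ((norm_nonneg _).trans (hxr 0)) ?_
      filter_upwards [hzr, hzm.coeFn_toLp] with ω h1 h2
      rwa [h2]
    · filter_upwards [hxz, hzm.coeFn_toLp] with ω h1 h2
      rwa [h2]
  · exact Lp.ext ((coeFn_toLtwo _).trans hzm.coeFn_toLp)

end Inclusion

/-! ### Dual representation of Fatou coherent risk measures -/

section Representation

variable {Ω : Type*} {m : MeasurableSpace Ω} {P : Measure Ω} [IsProbabilityMeasure P]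

open Classical in
variable (P) in
/-- The indicator function of a measurable set as an element of `L^∞`. -/
def indLInf (s : Set Ω) : LInf P :=
  if hs : MeasurableSet s then indicatorConstLp ∞ hs (measure_ne_top P s) (1 : ℝ) else 0

theorem coeFn_indLInf {s : Set Ω} (hs : MeasurableSet s) :
    indLInf P s =ᵐ[P] s.indicator fun _ => (1 : ℝ) := by
  rw [indLInf, dif_pos hs]
  exact indicatorConstLp_coeFn

theorem indLInf_of_not_measurable {s : Set Ω} (hs : ¬ MeasurableSet s) : indLInf P s = 0 :=
  dif_neg hs

theorem indLInf_nonneg (s : Set Ω) : 0 ≤ indLInf P s := by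
  by_cases hs : MeasurableSet s
  · rw [← Lp.coeFn_nonneg]
    filter_upwards [coeFn_indLInf (P := P) hs] with ω h
    rw [h]
    exact Set.indicator_nonneg (fun _ _ => zero_le_one) _
  · rw [indLInf_of_not_measurable hs]

theorem norm_indLInf_le {s : Set Ω} (hs : MeasurableSet s) : ‖indLInf P s‖ ≤ 1 := by
  refine Lp_norm_le_of_ae_abs_le zero_le_one ?_
  filter_upwards [coeFn_indLInf (P := P) hs] with ω h
  rw [h]
  by_cases hω : ω ∈ s <;> simp [hω]

theorem indLInf_union {s t : Set Ω} (hs : MeasurableSet s) (ht : MeasurableSet t)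
    (hst : Disjoint s t) : indLInf P (s ∪ t) = indLInf P s + indLInf P t := by
  refine Lp.ext ?_
  filter_upwards [coeFn_indLInf (P := P) hs, coeFn_indLInf (P := P) ht,
    coeFn_indLInf (P := P) (hs.union ht), Lp.coeFn_add (indLInf P s) (indLInf P t)]
    with ω h1 h2 h3 h4
  rw [h3, h4, Pi.add_apply, h1, h2, Set.indicator_union_of_disjoint hst]

theorem indLInf_eq_zero {s : Set Ω} (h0 : P s = 0) : indLInf P s = 0 := by
  by_cases hs : MeasurableSet s
  · refine Lp.ext ((coeFn_indLInf hs).trans ?_)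
    have h1 : ∀ᵐ ω ∂P, ω ∉ s := measure_eq_zero_iff_ae_notMem.1 h0
    filter_upwards [h1, Lp.coeFn_zero ℝ ∞ P] with ω h1 h2
    rw [h2, Set.indicator_of_notMem h1, Pi.zero_apply]
  · exact indLInf_of_not_measurable hs

theorem indLInf_univ : indLInf P Set.univ = Lp.const ∞ P 1 := by
  refine Lp.ext ((coeFn_indLInf MeasurableSet.univ).trans ?_)
  filter_upwards [Lp.coeFn_const ∞ P (1 : ℝ)] with ω h
  rw [h, Set.indicator_univ, Function.const_apply]

theorem const_eq_smul (c : ℝ) : (Lp.const ∞ P c : LInf P) = c • Lp.const ∞ P (1 : ℝ) := by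
  refine Lp.ext ?_
  filter_upwards [Lp.coeFn_const ∞ P (1 : ℝ), Lp.coeFn_const ∞ P c,
    Lp.coeFn_smul c (Lp.const ∞ P (1 : ℝ))] with ω h1 h2 h3
  rw [h2, h3, Pi.smul_apply, h1]
  simp

/-- A functional on `L^∞` that is continuous for the `L²`-norm on bounded sets. -/
def BoundedlyContinuous (g : LInf P →L[ℝ] ℝ) : Prop :=
  ∀ (M : ℝ) (x : ℕ → LInf P), (∀ k, ‖x k‖ ≤ M) →
    Tendsto (fun k => toLtwo P (x k)) atTop (𝓝 0) → Tendsto (fun k => g (x k)) atTop (𝓝 0)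

theorem BoundedlyContinuous.tendsto {g : LInf P →L[ℝ] ℝ} (hg : BoundedlyContinuous g)
    {Xs : ℕ → LInf P} {X : LInf P} {C : ℝ} (hC : ∀ n, ‖Xs n‖ ≤ C)
    (hX : ∀ᵐ ω ∂P, Tendsto (fun n => Xs n ω) atTop (𝓝 (X ω))) :
    Tendsto (fun n => g (Xs n)) atTop (𝓝 (g X)) := by
  have hb : ∀ n, ‖Xs n - X‖ ≤ C + ‖X‖ := fun n => (norm_sub_le _ _).trans (by gcongr; exact hC n)
  have := hg (C + ‖X‖) (fun n => Xs n - X) hb (tendsto_toLtwo_zero hb ?_)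
  · simpa using this.add_const (g X)
  · filter_upwards [hX, ae_all_iff.2 fun n => Lp.coeFn_sub (Xs n) X] with ω h1 h2
    simp_rw [h2, Pi.sub_apply]
    simpa using h1.sub_const (X ω)

/-- The signed measure `s ↦ g(1_s)`. -/
def signedMeasureOfFunctional (g : LInf P →L[ℝ] ℝ) (h0 : ∀ X, 0 ≤ X → 0 ≤ g X)
    (hg : BoundedlyContinuous g) : SignedMeasure Ω where
  measureOf' s := g (indLInf P s)
  empty' := by rw [indLInf_eq_zero (by simp), map_zero]
  not_measurable' s hs := by rw [indLInf_of_not_measurable hs, map_zero]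
  m_iUnion' A hA hd := by
    -- Positivity reduces the sum to its partial sums, which are values of `g` at indicators of
    -- finite unions: bounded by `1` and pointwise convergent.
    rw [hasSum_iff_tendsto_nat_of_nonneg fun i => h0 _ (indLInf_nonneg _)]
    have hUm : ∀ n : ℕ, MeasurableSet (⋃ i ∈ Finset.range n, A i) :=
      fun n => Finset.measurableSet_biUnion _ fun i _ => hA i
    have hsum : ∀ n : ℕ, ∑ i ∈ Finset.range n, g (indLInf P (A i))
        = g (indLInf P (⋃ i ∈ Finset.range n, A i)) := by
      intro n
      induction n with
      | zero => simp [indLInf_eq_zero]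
      | succ n ih =>
        rw [Finset.sum_range_succ, ih, Finset.range_add_one, Finset.set_biUnion_insert,
          Set.union_comm, indLInf_union (hUm n) (hA n), map_add]
        rw [Set.disjoint_iUnion₂_left]
        intro i hi
        exact hd (Finset.mem_range.1 hi).ne
    simp_rw [hsum]
    refine hg.tendsto (C := 1) (fun n => norm_indLInf_le (hUm n)) ?_
    filter_upwards [coeFn_indLInf (P := P) (MeasurableSet.iUnion hA),
      ae_all_iff.2 fun n => coeFn_indLInf (P := P) (hUm n)] with ω h1 h2
    simp_rw [h1, h2]
    refine tendsto_const_nhds.congr' ?_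
    by_cases hω : ω ∈ ⋃ i, A i
    · obtain ⟨i, hi⟩ := Set.mem_iUnion.1 hω
      filter_upwards [eventually_gt_atTop i] with n hn
      rw [Set.indicator_of_mem hω, Set.indicator_of_mem]
      exact Set.mem_biUnion (Finset.mem_coe.2 (Finset.mem_range.2 hn)) hi
    · refine Eventually.of_forall fun n => ?_
      beta_reduce
      rw [Set.indicator_of_notMem hω, Set.indicator_of_notMem]
      intro h
      obtain ⟨i, _, hi⟩ := Set.mem_iUnion₂.1 h
      exact hω (Set.mem_iUnion.2 ⟨i, hi⟩)

theorem expect_indLInf (μ : ACSigned P) {s : Set Ω} (hs : MeasurableSet s) :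
    expect μ (indLInf P s) = (μ : SignedMeasure Ω) s := by
  rw [expect_congr μ _ EventuallyEq.rfl (coeFn_indLInf hs), ← setIntegral_density μ hs,
    ← integral_indicator hs]
  refine integral_congr_ae (ae_of_all _ fun ω => ?_)
  by_cases hω : ω ∈ s <;> simp [hω]

/-- Both sides are linear and continuous along bounded a.s. convergent sequences, so simple
functions suffice. -/
theorem expect_eq_of_indLInf {g : LInf P →L[ℝ] ℝ} (hg : BoundedlyContinuous g) {μ : ACSigned P}
    (h : ∀ s, MeasurableSet s → expect μ (indLInf P s) = g (indLInf P s)) (X : LInf P) :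
    expect μ X = g X := by
  have hsimple : ∀ φ : SimpleFunc Ω ℝ, ∀ Y : LInf P, Y =ᵐ[P] φ → expect μ Y = g Y := by
    intro φ
    induction φ using SimpleFunc.induction with
    | const c hs =>
      rename_i s
      intro Y hY
      have : Y = c • indLInf P s := by
        refine Lp.ext (hY.trans ?_)
        filter_upwards [coeFn_indLInf (P := P) hs, Lp.coeFn_smul c (indLInf P s)] with ω h1 h2
        rw [h2, Pi.smul_apply, h1]
        by_cases hω : ω ∈ s <;> simp [hω]
      rw [this, expect_smul_right, map_smul, h s hs, smul_eq_mul]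
    | add _ ih1 ih2 =>
      rename_i φ ψ _
      intro Y hY
      have hφ := SimpleFunc.memLp_top φ P
      have hψ := SimpleFunc.memLp_top ψ P
      have : Y = hφ.toLp φ + hψ.toLp ψ := by
        refine Lp.ext (hY.trans ?_)
        filter_upwards [hφ.coeFn_toLp, hψ.coeFn_toLp, Lp.coeFn_add (hφ.toLp φ) (hψ.toLp ψ)]
          with ω h1 h2 h3
        rw [h3, Pi.add_apply, h1, h2]
        rfl
      rw [this, expect_add_right, map_add, ih1 _ hφ.coeFn_toLp, ih2 _ hψ.coeFn_toLp]
  have hM : (0 : ℝ) ∈ Set.Icc (-‖X‖) ‖X‖ := by simp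
  -- Truncating the representative everywhere keeps the simple approximants bounded by `‖X‖`.
  let x : Ω → ℝ := fun ω => max (-‖X‖) (min ‖X‖ (X ω))
  have hxm : Measurable x :=
    measurable_const.max (measurable_const.min (Lp.stronglyMeasurable X).measurable)
  have hxI : ∀ ω, x ω ∈ Set.Icc (-‖X‖) ‖X‖ := fun ω =>
    ⟨le_max_left _ _, max_le (by linarith [norm_nonneg X]) (min_le_left _ _)⟩
  have hxX : ∀ᵐ ω ∂P, x ω = X ω := by
    filter_upwards [LInf.bound X] with ω hω
    rw [abs_le] at hω
    simp only [x]
    rw [min_eq_right hω.2, max_eq_right hω.1]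
  let φ : ℕ → SimpleFunc Ω ℝ := SimpleFunc.approxOn x hxm (Set.Icc (-‖X‖) ‖X‖) 0 hM
  have hφ : ∀ n, MemLp (φ n) ∞ P := fun n => SimpleFunc.memLp_top (φ n) P
  have hb : ∀ n, ‖(hφ n).toLp (φ n)‖ ≤ ‖X‖ := by
    intro n
    refine Lp_norm_le_of_ae_abs_le (norm_nonneg _) ?_
    filter_upwards [(hφ n).coeFn_toLp] with ω h1
    rw [h1, abs_le]
    exact SimpleFunc.approxOn_mem hxm hM n ω
  have hlim : ∀ᵐ ω ∂P, Tendsto (fun n => (hφ n).toLp (φ n) ω) atTop (𝓝 (X ω)) := by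
    filter_upwards [hxX, ae_all_iff.2 fun n => (hφ n).coeFn_toLp] with ω h1 h2
    simp_rw [h2, ← h1]
    exact SimpleFunc.tendsto_approxOn hxm hM (subset_closure (hxI ω))
  refine tendsto_nhds_unique (tendsto_expect μ hb hlim) ?_
  simp_rw [fun n => hsimple (φ n) _ (hφ n).coeFn_toLp]
  exact hg.tendsto hb hlim

theorem exists_acProb_expect_eq {g : LInf P →L[ℝ] ℝ} (h0 : ∀ X, 0 ≤ X → 0 ≤ g X)
    (h1 : g (Lp.const ∞ P 1) = 1) (hg : BoundedlyContinuous g) :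
    ∃ μ ∈ ACProb P, ∀ X, expect μ X = g X := by
  have hac : signedMeasureOfFunctional g h0 hg ≪ᵥ P.toENNRealVectorMeasure := by
    refine VectorMeasure.AbsolutelyContinuous.mk fun s hs hPs => ?_
    rw [Measure.toENNRealVectorMeasure_apply_measurable hs] at hPs
    change g (indLInf P s) = 0
    rw [indLInf_eq_zero hPs, map_zero]
  refine ⟨⟨_, hac⟩, ⟨fun s _ => h0 _ (indLInf_nonneg s), ?_⟩, ?_⟩
  · change g (indLInf P Set.univ) = 1
    rw [indLInf_univ, h1]
  · exact expect_eq_of_indLInf hg fun s hs => expect_indLInf _ hs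

theorem Coherent.map_zero {ρ : LInf P → ℝ} (hρ : Coherent ρ) : ρ 0 = 0 := by
  simpa using hρ.positive_homogeneity 0 0 le_rfl

/-- Dual representation of Fatou coherent risk measures. -/
theorem Coherent.exists_lt_expect {ρ : LInf P → ℝ} (hρ : Coherent ρ) (hF : Fatou ρ) (X₀ : LInf P)
    {t : ℝ} (ht : t < ρ X₀) :
    ∃ μ ∈ ACProb P, (∀ X, expect μ X ≤ ρ X) ∧ t < expect μ X₀ := by
  let C : Set (LInf P) := {Z | ρ (X₀ - Z) ≤ t}
  have hCcv : Convex ℝ C := by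
    intro Z hZ W hW a b ha hb hab
    have e : X₀ - (a • Z + b • W) = a • (X₀ - Z) + (1 - a) • (X₀ - W) := by
      obtain rfl : b = 1 - a := by linarith
      module
    change ρ (X₀ - (a • Z + b • W)) ≤ t
    rw [e]
    have hZ' : ρ (X₀ - Z) ≤ t := hZ
    have hW' : ρ (X₀ - W) ≤ t := hW
    have := hρ.convexity (X₀ - Z) (X₀ - W) a ha (by linarith)
    nlinarith
  have hC0 : (0 : LInf P) ∉ C := by
    intro h
    have : ρ (X₀ - 0) ≤ t := h
    rw [sub_zero] at this
    linarith
  obtain ⟨f, u, hu, hfC, hfc⟩ := exists_separating_functional (toLtwo P) toLtwo_injective hCcv hC0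
    (fun n => isClosed_toLtwo_image subset_rfl fun _ X _ hX _ => mem_closedBall_zero_iff.2 hX)
    (fun n => isClosed_toLtwo_image Set.inter_subset_right fun Xs X hXs hX hlim => by
      refine ⟨?_, mem_closedBall_zero_iff.2 hX⟩
      -- The Fatou property gives closedness of the bounded parts of `C`.
      have h1 := hF (fun k => X₀ - Xs k) (X₀ - X) ⟨‖X₀‖ + n, fun k =>
        (norm_sub_le _ _).trans (by gcongr; exact mem_closedBall_zero_iff.1 (hXs k).2)⟩ (by
          filter_upwards [hlim, Lp.coeFn_sub X₀ X,
            ae_all_iff.2 fun k => Lp.coeFn_sub X₀ (Xs k)] with ω g1 g2 g3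
          simp_rw [g2, g3, Pi.sub_apply]
          exact g1.const_sub _)
      have h2 : liminf (fun k => (ρ (X₀ - Xs k) : EReal)) atTop ≤ (t : EReal) := by
        refine (liminf_le_liminf (v := fun _ => (t : EReal))
          (Eventually.of_forall fun k => ?_)).trans (liminf_const _).le
        exact EReal.coe_le_coe_iff.2 (hXs k).1
      exact EReal.coe_le_coe_iff.1 (h1.trans h2))
  set e : LInf P := Lp.const ∞ P (1 : ℝ) with he
  have hf1 : ∀ Y, ρ Y ≤ t → f Y + u ≤ f X₀ := by
    intro Y hY
    have : X₀ - Y ∈ C := by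
      change ρ (X₀ - (X₀ - Y)) ≤ t
      rwa [sub_sub_cancel]
    have := hfC _ this
    rw [map_sub] at this
    linarith
  have hcash : ∀ (X : LInf P) (c : ℝ), ρ (X + c • e) = ρ X + c := by
    intro X c
    rw [he, ← const_eq_smul, hρ.cash_invariance]
  -- If `f A > 0`, a large multiple of `A` added to `t • e` would keep `ρ` at most `t` but violate
  -- `hf1`; `a` is chosen so that `f` reaches at least `f X₀`.
  have hf2 : ∀ A, ρ A ≤ 0 → f A ≤ 0 := by
    intro A hA
    by_contra! hpos
    set a := (|f X₀| + |t * f e|) / f A with ha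
    have ha0 : 0 ≤ a := by positivity
    have h1 : ρ (a • A + t • e) ≤ t := by
      rw [hcash, hρ.positive_homogeneity _ _ ha0]
      nlinarith
    have h2 := hf1 _ h1
    rw [map_add, map_smul, map_smul, smul_eq_mul, smul_eq_mul, ha,
      div_mul_cancel₀ _ hpos.ne'] at h2
    linarith [le_abs_self (f X₀), neg_abs_le (t * f e)]
  have hf3 : ∀ X, 0 ≤ X → 0 ≤ f X := by
    intro X hX
    have : ρ (-X) ≤ 0 := by
      rw [← hρ.map_zero]
      exact hρ.monotonicity _ _ (neg_nonpos.2 hX)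
    have := hf2 _ this
    rw [map_neg] at this
    linarith
  have hfρ : ∀ X, f X ≤ ρ X * f e := by
    intro X
    have : ρ (X + (-ρ X) • e) ≤ 0 := by rw [hcash]; simp
    have := hf2 _ this
    rw [map_add, map_smul, smul_eq_mul] at this
    linarith
  have ht1 : t * f e + u ≤ f X₀ := by
    have : ρ (0 + t • e) ≤ t := by rw [hcash, hρ.map_zero, zero_add]
    have := hf1 _ this
    rwa [zero_add, map_smul, smul_eq_mul] at this
  -- Combining `ht1` with `hfρ X₀` gives `(ρ X₀ - t) * f e ≥ u > 0`.
  have hfe0 : 0 < f e := by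
    have := hfρ X₀
    nlinarith
  obtain ⟨μ, hμ, hμf⟩ := exists_acProb_expect_eq (g := (f e)⁻¹ • f)
    (fun X hX => mul_nonneg (inv_nonneg.2 hfe0.le) (hf3 X hX))
    (inv_mul_cancel₀ hfe0.ne')
    (fun M x hM hx => by
      have := (hfc M x hM hx).const_mul (f e)⁻¹
      simpa using this)
  have hμf' : ∀ X, expect μ X = f X / f e := by
    intro X
    rw [hμf, div_eq_inv_mul]
    rfl
  refine ⟨μ, hμ, fun X => ?_, ?_⟩
  · rw [hμf', div_le_iff₀ hfe0]
    exact hfρ X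
  · rw [hμf', lt_div_iff₀ hfe0]
    linarith

end Representation

/-! ### Weak closures and support functions -/

section WeakClosure

variable {Ω : Type*} {m : MeasurableSpace Ω} {Q : Measure Ω}

theorem expect_le_of_mem_closure {R : Set (ACSigned Q)} {X : LInf Q} {c : ℝ}
    (h : ∀ ν ∈ R, expect ν X ≤ c) {ν : ACSigned Q} (hν : ν ∈ closure[weakTopology Q] R) :
    expect ν X ≤ c := by
  let _ := weakTopology Q
  have hcont : Continuous fun ν : ACSigned Q => expect ν X :=
    (continuous_apply X).comp (f := fun ν Y => expect ν Y) continuous_induced_dom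
  exact closure_minimal (s := R) (t := {ν | expect ν X ≤ c}) h
    (isClosed_le hcont continuous_const) hν

/-- `E^μ` as a linear functional on `L^∞`. -/
def expectₗ (μ : ACSigned Q) : LInf Q →ₗ[ℝ] ℝ where
  toFun := expect μ
  map_add' := expect_add_right μ
  map_smul' := expect_smul_right μ

/-- Bipolar theorem for `w(ℳ, L^∞)`-closures of convex sets. -/
theorem mem_closure_of_forall_expect_le [SigmaFinite Q] {R : Set (ACSigned Q)} (hR : Convex ℝ R)
    {ν₀ : ACSigned Q}
    (h : ∀ (X : LInf Q) (c : ℝ), (∀ ν ∈ R, expect ν X ≤ c) → expect ν₀ X ≤ c) :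
    ν₀ ∈ closure[weakTopology Q] R := by
  rw [closure_induced, mem_closure_iff_nhds]
  intro N hN
  rw [nhds_pi, Filter.mem_pi] at hN
  obtain ⟨I, hI, t, ht, hIt⟩ := hN
  have : Fintype I := hI.fintype
  classical
  -- A basic weak neighbourhood tests finitely many `X`, so the separation takes place in a
  -- finite-dimensional space.
  let ψ : ACSigned Q → I → ℝ := fun ν i => expect ν i
  have hK : Convex ℝ (ψ '' R) := by
    rintro _ ⟨μ, hμ, rfl⟩ _ ⟨ν, hν, rfl⟩ a b ha hb hab
    refine ⟨a • μ + b • ν, hR hμ hν ha hb hab, funext fun i => ?_⟩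
    simp only [ψ, expect_add_left, expect_smul_left, Pi.add_apply, Pi.smul_apply, smul_eq_mul]
  have hmem : ψ ν₀ ∈ closure (ψ '' R) := by
    by_contra hnot
    obtain ⟨f, u, hf1, hf2⟩ := geometric_hahn_banach_closed_point hK.closure isClosed_closure hnot
    -- The separating functional becomes the pairing with a single element of `L^∞`.
    let X : LInf Q := ∑ i : I, f (Pi.single i 1) • (i : LInf Q)
    have hX : ∀ ν : ACSigned Q, expect ν X = f (ψ ν) := by
      intro ν
      have h1 : expect ν X = ∑ i : I, f (Pi.single i 1) * expect ν i := by
        change expectₗ ν X = _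
        simp only [X, map_sum, map_smul, smul_eq_mul]
        rfl
      have h2 := LinearMap.pi_apply_eq_sum_univ (f : (I → ℝ) →ₗ[ℝ] ℝ) (ψ ν)
      rw [h1]
      refine Eq.trans ?_ h2.symm
      refine Finset.sum_congr rfl fun i _ => ?_
      rw [smul_eq_mul, mul_comm]
      congr 1
      change f _ = f _
      congr 1
      funext j
      simp [Pi.single_apply, eq_comm]
    have := h X u fun ν hν => by
      rw [hX]
      exact (hf1 _ (subset_closure ⟨ν, hν, rfl⟩)).le
    rw [hX] at this
    linarith
  have hnb : Set.univ.pi (fun i : I => t i) ∈ 𝓝 (ψ ν₀) :=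
    set_pi_mem_nhds Set.finite_univ fun i _ => ht i
  obtain ⟨_, hy, ν, hν, rfl⟩ := mem_closure_iff_nhds.1 hmem _ hnb
  exact ⟨_, hIt fun i hi => hy ⟨i, hi⟩ trivial, ν, hν, rfl⟩

/-- A supremum of functionals continuous along bounded a.s. convergence is lower semicontinuous
along it. -/
theorem fatou_of_isLUB {ρ : LInf Q → ℝ} {S : Set (ACSigned Q)}
    (hlub : ∀ X : LInf Q, IsLUB ((fun μ => expect μ X) '' S) (ρ X)) :
    Fatou ρ := by
  rintro Xs X ⟨C, hC⟩ hX
  refine le_of_forall_lt fun a ha => ?_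
  obtain ⟨b, hab, hb⟩ := EReal.lt_iff_exists_real_btwn.1 ha
  rw [EReal.coe_lt_coe_iff] at hb
  obtain ⟨_, ⟨μ, hμ, rfl⟩, hbμ⟩ := (lt_isLUB_iff (hlub X)).1 hb
  refine hab.trans_le ?_
  refine le_liminf_of_le (by isBoundedDefault) ?_
  filter_upwards [(tendsto_expect μ hC hX).eventually (lt_mem_nhds hbμ)] with n hn
  exact EReal.coe_le_coe_iff.2 (hn.le.trans ((hlub (Xs n)).1 ⟨μ, hμ, rfl⟩))

end WeakClosure

/-! ### Transfer between `𝒢`-measurable variables and the trimmed space -/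

section Transfer

variable {Ω : Type*} {𝒢 mΩ : MeasurableSpace Ω} {P : Measure[mΩ] Ω}

theorem convex_image_restrictSub (h𝒢 : 𝒢 ≤ mΩ) {S : Set (ACSigned P)} (hS : Convex ℝ S) :
    Convex ℝ (restrictSub h𝒢 '' S) := by
  rintro _ ⟨μ, hμ, rfl⟩ _ ⟨ν, hν, rfl⟩ a b ha hb hab
  refine ⟨a • μ + b • ν, hS hμ hν ha hb hab, Subtype.ext (VectorMeasure.ext fun s hs => ?_)⟩
  have e : ∀ κ : ACSigned P, (restrictSub h𝒢 κ).1 s = κ.1 s :=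
    fun κ => VectorMeasure.trim_measurableSet_eq h𝒢 hs
  change (restrictSub h𝒢 (a • μ + b • ν)).1 s =
    a * (restrictSub h𝒢 μ).1 s + b * (restrictSub h𝒢 ν).1 s
  rw [e, e, e]
  rfl

theorem exists_lInf_of_trim (h𝒢 : 𝒢 ≤ mΩ) (X' : LInf (P.trim h𝒢)) :
    ∃ X : LInf P, AEStronglyMeasurable[𝒢] X P ∧ X' =ᵐ[P] X :=
  ⟨lpTrimToLpMeas ℝ ℝ ∞ P h𝒢 X',
    mem_lpMeas_iff_aestronglyMeasurable.1 (lpTrimToLpMeas ℝ ℝ ∞ P h𝒢 X').2,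
    (lpTrimToLpMeas_ae_eq h𝒢 X').symm⟩

theorem exists_lInf_trim (h𝒢 : 𝒢 ≤ mΩ) {X : LInf P} (hX : AEStronglyMeasurable[𝒢] X P) :
    ∃ X' : LInf (P.trim h𝒢), X' =ᵐ[P] X :=
  ⟨lpMeasToLpTrim ℝ ℝ ∞ P h𝒢 ⟨X, mem_lpMeas_iff_aestronglyMeasurable.2 hX⟩,
    lpMeasToLpTrim_ae_eq h𝒢 _⟩

theorem map_trim_eq (h𝒢 : 𝒢 ≤ mΩ) {f : Ω → ℝ} (hf : Measurable[𝒢] f) :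
    @Measure.map Ω ℝ 𝒢 _ f (P.trim h𝒢) = P.map f := by
  ext s hs
  rw [Measure.map_apply hf hs, Measure.map_apply (hf.mono h𝒢 le_rfl) hs,
    trim_measurableSet_eq h𝒢 (hf hs)]

theorem identDistrib_iff_map_eq {m : MeasurableSpace Ω} {Q : Measure Ω} {f g : Ω → ℝ}
    (hf : Measurable f) (hg : Measurable g) : IdentDistrib f g Q Q ↔ Q.map f = Q.map g :=
  ⟨fun h => h.map_eq, fun h => ⟨hf.aemeasurable, hg.aemeasurable, h⟩⟩

theorem identDistrib_trim_iff (h𝒢 : 𝒢 ≤ mΩ) {f g : Ω → ℝ} (hf : Measurable[𝒢] f)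
    (hg : Measurable[𝒢] g) :
    @IdentDistrib Ω Ω ℝ 𝒢 𝒢 _ f g (P.trim h𝒢) (P.trim h𝒢) ↔ IdentDistrib f g P P := by
  rw [identDistrib_iff_map_eq hf hg,
    identDistrib_iff_map_eq (hf.mono h𝒢 le_rfl) (hg.mono h𝒢 le_rfl), map_trim_eq h𝒢 hf,
    map_trim_eq h𝒢 hg]

theorem measurable_lInf {m : MeasurableSpace Ω} {Q : Measure Ω} (X : LInf Q) : Measurable X :=
  (Lp.stronglyMeasurable X).measurable

theorem identDistrib_trim_lInf_iff (h𝒢 : 𝒢 ≤ mΩ) {X' Y' : LInf (P.trim h𝒢)} {X Y : LInf P}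
    (hX : X' =ᵐ[P] X) (hY : Y' =ᵐ[P] Y) :
    @IdentDistrib Ω Ω ℝ 𝒢 𝒢 _ X' Y' (P.trim h𝒢) (P.trim h𝒢) ↔ IdentDistrib X Y P P := by
  rw [identDistrib_trim_iff h𝒢 (measurable_lInf X') (measurable_lInf Y')]
  have h1 : IdentDistrib X X' P P :=
    IdentDistrib.of_ae_eq (measurable_lInf X).aemeasurable hX.symm
  have h2 : IdentDistrib Y Y' P P :=
    IdentDistrib.of_ae_eq (measurable_lInf Y).aemeasurable hY.symm
  exact ⟨fun h => h1.trans (h.trans h2.symm), fun h => h1.symm.trans (h.trans h2)⟩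

end Transfer

/-! ### Law invariance of a support function and of its set -/

section LawInvariance

variable {Ω : Type*} {m : MeasurableSpace Ω} {Q : Measure Ω} [IsFiniteMeasure Q]
  {σ : LInf Q → ℝ} {R : Set (ACSigned Q)}

/-- For `Z` distributed as the density of `ν`, some `w` with the law of `X` makes `E^ν[w]` close to
`∫ Z X`, while `E^ν[w] ≤ σ w = σ X`. The bipolar theorem puts `Z` in the closure. -/
theorem AlmostLawInvariant.of_support (hQ : Halving Q) (hR : Convex ℝ R)
    (hlub : ∀ X : LInf Q, IsLUB ((fun ν => expect ν X) '' R) (σ X))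
    (hσ : ∀ X Y : LInf Q, IdentDistrib X Y Q Q → σ X = σ Y) : AlmostLawInvariant R := by
  rintro _ ⟨ν, hν, rfl⟩ Z hZ
  have hZi : Integrable Z Q := hZ.integrable_snd (integrable_density ν)
  have hdens : density (ofDensity Z : ACSigned Q) =ᵐ[Q] Z := density_ofDensity hZi
  refine ⟨ofDensity Z, ?_, AEEqFun.ext hdens⟩
  refine mem_closure_of_forall_expect_le hR fun X c hc => ?_
  have hσc : σ X ≤ c := (hlub X).2 (Set.forall_mem_image.2 hc)
  refine le_of_forall_pos_le_add fun ε hε => ?_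
  have hXi : Integrable X Q := (Lp.memLp X).integrable le_top
  have hint : Integrable (fun ω => Z ω * X ω) Q :=
    (integrable_density_mul (ofDensity Z) X).congr (hdens.mul EventuallyEq.rfl)
  obtain ⟨w, hwm, hw, hwε⟩ := hQ.exists_identDistrib_integral_mul hZ.symm hXi hint hε
  have hwL : MemLp w ∞ Q := hw.memLp_snd (Lp.memLp X)
  have h1 : expect ν (hwL.toLp w) ≤ σ X := by
    rw [hσ X (hwL.toLp w)
      (hw.trans (IdentDistrib.of_ae_eq hwm.aemeasurable hwL.coeFn_toLp.symm))]
    exact expect_le_of_mem_closure (fun κ hκ => (hlub _).1 ⟨κ, hκ, rfl⟩) hν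
  rw [expect_congr ν _ EventuallyEq.rfl hwL.coeFn_toLp] at h1
  rw [expect_congr _ X hdens EventuallyEq.rfl]
  linarith [(abs_le.1 hwε).1]

/-- Here the density is rearranged: its copy, adapted to `Y`, is the density of a measure in the
closure of `R`, on which `σ Y` is still an upper bound. -/
theorem AlmostLawInvariant.support_eq (hQ : Halving Q) (hR : AlmostLawInvariant R)
    (hlub : ∀ X : LInf Q, IsLUB ((fun ν => expect ν X) '' R) (σ X)) {X Y : LInf Q}
    (hXY : IdentDistrib X Y Q Q) : σ X = σ Y := by
  have key : ∀ X Y : LInf Q, IdentDistrib X Y Q Q → σ X ≤ σ Y := by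
    intro X Y hXY
    refine (hlub X).2 (Set.forall_mem_image.2 fun ν hν => ?_)
    refine le_of_forall_pos_le_add fun ε hε => ?_
    have hint : Integrable (fun ω => X ω * density ν ω) Q := by
      simpa only [mul_comm] using integrable_density_mul ν X
    obtain ⟨w, hwm, hw, hwε⟩ :=
      hQ.exists_identDistrib_integral_mul hXY (integrable_density ν) hint hε
    let Z : Ω →ₘ[Q] ℝ := AEEqFun.mk w hwm.aestronglyMeasurable
    have hZ : Z =ᵐ[Q] w := AEEqFun.coeFn_mk _ _
    obtain ⟨ν', hν', hν'Z⟩ := hR (density ν) ⟨ν, @subset_closure _ (weakTopology Q) _ _ hν, rfl⟩ Z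
      (hw.trans (IdentDistrib.of_ae_eq hwm.aemeasurable hZ.symm))
    have h1 : expect ν' Y ≤ σ Y :=
      expect_le_of_mem_closure (fun κ hκ => (hlub Y).1 ⟨κ, hκ, rfl⟩) hν'
    rw [expect_congr ν' Y (hν'Z ▸ hZ) EventuallyEq.rfl] at h1
    have h2 := (abs_le.1 hwε).1
    simp_rw [mul_comm (Y _), mul_comm (X _)] at h2
    change ∫ ω, density ν ω * X ω ∂Q ≤ _
    linarith
  exact le_antisymm (key X Y hXY) (key Y X hXY.symm)

end LawInvariance

/-! ### Partial law invariance for one sub-σ-algebra -/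

section SubSigmaAlgebra

variable {Ω : Type*} {𝒢 mΩ : MeasurableSpace Ω} {P : Measure[mΩ] Ω} [IsFiniteMeasure P]
  {ρ : LInf P → ℝ} {S : Set (ACSigned P)}

theorem isLUB_expect_restrictSub (h𝒢 : 𝒢 ≤ mΩ) {X' : LInf (P.trim h𝒢)} {X : LInf P}
    (hX : X' =ᵐ[P] X) (hlub : IsLUB ((fun μ => expect μ X) '' S) (ρ X)) :
    IsLUB ((fun ν => expect ν X') '' (restrictSub h𝒢 '' S)) (ρ X) := by
  rw [Set.image_image]
  simpa only [expect_restrictSub h𝒢 _ hX] using hlub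

theorem LawInvariant.almostLawInvariant (h𝒢 : 𝒢 ≤ mΩ) (hat : Atomless (P.trim h𝒢))
    (hρ : LawInvariant 𝒢 ρ) (hS : Convex ℝ S)
    (hlub : ∀ X : LInf P, IsLUB ((fun μ => expect μ X) '' S) (ρ X)) :
    AlmostLawInvariant (restrictSub h𝒢 '' S) := by
  choose L hLm hL using exists_lInf_of_trim (P := P) h𝒢
  exact AlmostLawInvariant.of_support (σ := fun X' => ρ (L X')) hat.halving
    (convex_image_restrictSub h𝒢 hS) (fun X' => isLUB_expect_restrictSub h𝒢 (hL X') (hlub _))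
    fun X' Y' h => hρ _ _ (hLm X') (hLm Y') ((identDistrib_trim_lInf_iff h𝒢 (hL X') (hL Y')).1 h)

theorem AlmostLawInvariant.lawInvariant (h𝒢 : 𝒢 ≤ mΩ) (hat : Atomless (P.trim h𝒢))
    (hS : AlmostLawInvariant (restrictSub h𝒢 '' S))
    (hlub : ∀ X : LInf P, IsLUB ((fun μ => expect μ X) '' S) (ρ X)) : LawInvariant 𝒢 ρ := by
  choose L hLm hL using exists_lInf_of_trim (P := P) h𝒢
  have hext : ∀ (X : LInf P) (X' : LInf (P.trim h𝒢)), X' =ᵐ[P] X → L X' = X :=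
    fun X X' h => Lp.ext ((hL X').symm.trans h)
  intro X Y hXm hYm hXY
  obtain ⟨X', hX⟩ := exists_lInf_trim h𝒢 hXm
  obtain ⟨Y', hY⟩ := exists_lInf_trim h𝒢 hYm
  have := hS.support_eq (σ := fun X' => ρ (L X')) hat.halving
    (fun X' => isLUB_expect_restrictSub h𝒢 (hL X') (hlub _))
    ((identDistrib_trim_lInf_iff h𝒢 hX hY).2 hXY)
  simpa only [hext X X' hX, hext Y Y' hY] using this

end SubSigmaAlgebra

/-! ### Coherence of suprema and the maximal representing set -/

section Sup

variable {Ω : Type*} {m : MeasurableSpace Ω} {P : Measure Ω} [IsProbabilityMeasure P]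
  {ρ : LInf P → ℝ} {S : Set (ACSigned P)}

theorem coherent_of_isLUB (hS : S ⊆ ACProb P)
    (hlub : ∀ X : LInf P, IsLUB ((fun μ => expect μ X) '' S) (ρ X)) : Coherent ρ := by
  have hle : ∀ {μ} (_ : μ ∈ S) (X : LInf P), expect μ X ≤ ρ X :=
    fun {μ} hμ X => (hlub X).1 ⟨μ, hμ, rfl⟩
  have hsup : ∀ {X : LInf P} {c : ℝ}, (∀ μ ∈ S, expect μ X ≤ c) → ρ X ≤ c := by
    intro X c h
    refine (hlub X).2 ?_
    rintro _ ⟨μ, hμ, rfl⟩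
    exact h μ hμ
  have hconst : ∀ {μ} (_ : μ ∈ S) (c : ℝ), expect μ (Lp.const ∞ P c) = c := by
    intro μ hμ c
    rw [expect_const, (hS hμ).2, mul_one]
  have hsmul : ∀ (X : LInf P) (l : ℝ), 0 ≤ l → ρ (l • X) ≤ l * ρ X := by
    intro X l hl
    refine hsup fun μ hμ => ?_
    rw [expect_smul_right]
    exact mul_le_mul_of_nonneg_left (hle hμ X) hl
  refine ⟨fun X c => le_antisymm ?_ ?_, fun X Y hXY => ?_, fun X Y l hl0 hl1 => ?_,
    fun X l hl => le_antisymm (hsmul X l hl) ?_⟩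
  · refine hsup fun μ hμ => ?_
    rw [expect_add_right, hconst hμ]
    linarith [hle hμ X]
  · have : ρ X ≤ ρ (X + Lp.const ∞ P c) - c := by
      refine hsup fun μ hμ => ?_
      have := hle hμ (X + Lp.const ∞ P c)
      rw [expect_add_right, hconst hμ] at this
      linarith
    linarith
  · exact hsup fun μ hμ => (expect_mono (hS hμ).1 hXY).trans (hle hμ Y)
  · refine hsup fun μ hμ => ?_
    rw [expect_add_right, expect_smul_right, expect_smul_right]
    have h1 := mul_le_mul_of_nonneg_left (hle hμ X) hl0
    have h2 := mul_le_mul_of_nonneg_left (hle hμ Y) (sub_nonneg.2 hl1)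
    linarith
  · rcases hl.eq_or_lt with rfl | hl
    · rw [zero_mul, zero_smul]
      -- A real least upper bound forces `S` to be nonempty, which gives `0 ≤ ρ 0`.
      obtain ⟨_, μ, hμ, rfl⟩ := (hlub 0).nonempty
      have := hle hμ 0
      rwa [show expect μ (0 : LInf P) = 0 from map_zero (expectₗ μ)] at this
    · have := hsmul (l • X) l⁻¹ (inv_nonneg.2 hl.le)
      rw [inv_smul_smul₀ hl.ne', ← div_eq_inv_mul, le_div_iff₀ hl] at this
      linarith

/-- The set of all probability measures dominated by `ρ`. -/
def dualSet (ρ : LInf P → ℝ) : Set (ACSigned P) :=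
  {μ | μ ∈ ACProb P ∧ ∀ X, expect μ X ≤ ρ X}

theorem convex_dualSet (ρ : LInf P → ℝ) : Convex ℝ (dualSet ρ) := by
  rintro μ ⟨⟨hμ0, hμ1⟩, hμ⟩ ν ⟨⟨hν0, hν1⟩, hν⟩ a b ha hb hab
  refine ⟨⟨fun s hs => ?_, ?_⟩, fun X => ?_⟩
  · have h1 : 0 ≤ μ.1 s := hμ0 s hs
    have h2 : 0 ≤ ν.1 s := hν0 s hs
    change 0 ≤ a * μ.1 s + b * ν.1 s
    positivity
  · change a * μ.1 Set.univ + b * ν.1 Set.univ = 1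
    rw [hμ1, hν1, mul_one, mul_one, hab]
  · rw [expect_add_left, expect_smul_left, expect_smul_left]
    have h1 := mul_le_mul_of_nonneg_left (hμ X) ha
    have h2 := mul_le_mul_of_nonneg_left (hν X) hb
    calc _ ≤ a * ρ X + b * ρ X := add_le_add h1 h2
      _ = ρ X := by rw [← add_mul, hab, one_mul]

theorem Coherent.isLUB_dualSet (hρ : Coherent ρ) (hF : Fatou ρ) (X : LInf P) :
    IsLUB ((fun μ => expect μ X) '' dualSet ρ) (ρ X) := by
  refine ⟨?_, fun c hc => ?_⟩
  · rintro _ ⟨μ, hμ, rfl⟩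
    exact hμ.2 X
  · by_contra! h
    obtain ⟨μ, hμ, hμρ, hμX⟩ := hρ.exists_lt_expect hF X h
    exact absurd (hc ⟨μ, ⟨hμ, hμρ⟩, rfl⟩) (not_le.2 hμX)

end Sup

end PartialLaw

end

theorem theorem2 {Ω : Type*} {mΩ : MeasurableSpace Ω} (P : Measure Ω) [IsProbabilityMeasure P]
    (𝔊 : Set (MeasurableSpace Ω)) (h𝔊 : 𝔊 ⊆ PartialLaw.AtomlessSub P)
    (ρ : PartialLaw.LInf P → ℝ) :
    (PartialLaw.Fatou ρ ∧ (∀ 𝒢 ∈ 𝔊, PartialLaw.LawInvariant 𝒢 ρ) ∧ PartialLaw.Coherent ρ) ↔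
      ∃ S : Set (PartialLaw.ACSigned P), S ⊆ PartialLaw.ACProb P ∧ Convex ℝ S ∧
        (∀ (𝒢 : MeasurableSpace Ω) (h : 𝒢 ∈ 𝔊),
          PartialLaw.AlmostLawInvariant (PartialLaw.restrictSub (h𝔊 h).1 '' S)) ∧
        ∀ X : PartialLaw.LInf P, IsLUB ((fun μ => PartialLaw.expect μ X) '' S) (ρ X) := by
  constructor
  · rintro ⟨hF, hinv, hρ⟩
    exact ⟨PartialLaw.dualSet ρ, fun μ hμ => hμ.1, PartialLaw.convex_dualSet ρ,
      fun 𝒢 h => (hinv 𝒢 h).almostLawInvariant _ (h𝔊 h).2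
        (PartialLaw.convex_dualSet ρ) (hρ.isLUB_dualSet hF), hρ.isLUB_dualSet hF⟩
  · rintro ⟨S, hS, -, hinv, hlub⟩
    exact ⟨PartialLaw.fatou_of_isLUB hlub, fun 𝒢 h =>
      (hinv 𝒢 h).lawInvariant _ (h𝔊 h).2 hlub,
      PartialLaw.coherent_of_isLUB hS hlub⟩
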